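/- Let $(M,g)$ be a smooth Riemannian manifold (Hausdorff, second countable, without boundary), let $\mathcal F$ be a smooth foliation of $M$ (of any dimension and codimension), and let $1<p<\infty$. Denote by $\mu_M$ the Riemannian volume measure of $M$ and by $\mu_L$ the Riemannian volume measure of a leaf $L\in\mathcal F$ with the induced metric. For a subfamily $\mathcal L\subset\mathcal F$, a property holds for almost every $L\in\mathcal L$ if the union of the leaves of $\mathcal L$ for which it fails has $\mu_M$-measure zero. Let $\mathrm{adm}_p(\mathcal L)$ be the set of all nonnegative $f\in L^p(M)$ with $\int_L f\,d\mu_L\ge 1$ for almost every $L\in\mathcal L$, and put $\mathrm{mod}_p(\mathcal L)=\inf_{f\in\mathrm{adm}_p(\mathcal L)}\|f\|_p$, where $\inf\emptyset=\infty$. A function $f_0\in\mathrm{adm}_p(\mathcal F)$ is called extremal for the $p$-modulus of $\mathcal F$ if $\|f_0\|_p=\mathrm{mod}_p(\mathcal F)$. Suppose that $\mathrm{adm}_p(\mathcal F)\neq\emptyset$. Then there is an extremal function for the $p$-modulus of $\mathcal F$ if and only if $\mathrm{mod}_p(\mathcal L)>0$ for every subfamily $\mathcal L\subset\mathcal F$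 whose union $\bigcup\mathcal L$ is $\mu_M$-measurable with $\mu_M(\bigcup\mathcal L)>0$. -/

import Mathlib

open MeasureTheory Set Topology
open scoped Manifold ContDiff ENNReal

noncomputable section

section RiemannianMeasure

variable {n : ℕ} {M : Type*} [TopologicalSpace M] [ChartedSpace (EuclideanSpace ℝ (Fin n)) M]

/-- A smooth Riemannian metric on the smooth `n`-dimensional manifold `M`. -/
abbrev RiemMetric (n : ℕ) (M : Type*) [TopologicalSpace M]
    [ChartedSpace (EuclideanSpace ℝ (Fin n)) M] [IsManifold (𝓡 n) ∞ M] : Type _ :=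
  Bundle.ContMDiffRiemannianMetric (𝓡 n) ∞ (EuclideanSpace ℝ (Fin n))
    (fun x : M => TangentSpace (𝓡 n) x)

variable [IsManifold (𝓡 n) ∞ M]

/-- The Riemannian volume density of an `m`-dimensional parametrization `ψ` at the point `u`:
the square root of the determinant of the Gram matrix `g (∂ᵢψ, ∂ⱼψ)`. -/
def volumeDensity (g : RiemMetric n M) {m : ℕ} (ψ : EuclideanSpace ℝ (Fin m) → M)
    (u : EuclideanSpace ℝ (Fin m)) : ℝ≥0∞ :=
  ENNReal.ofReal (Real.sqrt (Matrix.det (Matrix.of fun i j : Fin m =>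
    g.inner (ψ u)
      (mfderiv (𝓡 m) (𝓡 n) ψ u (EuclideanSpace.single i (1 : ℝ)))
      (mfderiv (𝓡 m) (𝓡 n) ψ u (EuclideanSpace.single j (1 : ℝ))))))

variable [MeasurableSpace M]

/-- The `m`-dimensional Riemannian volume of the piece `ψ(V)` that is parametrized by `ψ` on `V`
(a smooth embedding of an open set `V ⊆ ℝᵐ` in all uses), as a measure on `M`:
the image under `ψ` of `√det(g(∂ᵢψ, ∂ⱼψ)) du` on `V`. -/
def parametrizedVolume (g : RiemMetric n M) {m : ℕ} (ψ : EuclideanSpace ℝ (Fin m) → M)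
    (V : Set (EuclideanSpace ℝ (Fin m))) : Measure M :=
  ((volume.restrict V).withDensity (volumeDensity g ψ)).map ψ

/-- The Riemannian volume (Lebesgue) measure `μ_M` of `(M, g)`. The local volumes of the chart
domains agree on overlaps, and the global measure that they are the restrictions of
is their supremum in the lattice of measures. -/
def riemannianVolume (g : RiemMetric n M) : Measure M :=
  ⨆ φ ∈ atlas (EuclideanSpace ℝ (Fin n)) M, parametrizedVolume g φ.symm φ.target

end RiemannianMeasure

/-- A smooth foliation of dimension `k` and codimension `q` of a smooth manifold `M` of
dimension `k + q`, given by a foliated atlas: smooth charts onto products `V × W ⊆ ℝᵏ × ℝ^q`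
with `V` connected, which cover `M`, and whose transition maps are locally of the form
`(x, y) ↦ (h₁ (x, y), h₂ y)`. -/
structure Foliation (k q : ℕ) (M : Type*) [TopologicalSpace M]
    [ChartedSpace (EuclideanSpace ℝ (Fin (k + q))) M] where
  charts : Set (OpenPartialHomeomorph M (EuclideanSpace ℝ (Fin k) × EuclideanSpace ℝ (Fin q)))
  smooth : ∀ φ ∈ charts, ContMDiffOn (𝓡 (k + q))
    𝓘(ℝ, EuclideanSpace ℝ (Fin k) × EuclideanSpace ℝ (Fin q)) ∞ φ φ.source
  smooth_symm : ∀ φ ∈ charts, ContMDiffOn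
    𝓘(ℝ, EuclideanSpace ℝ (Fin k) × EuclideanSpace ℝ (Fin q)) (𝓡 (k + q)) ∞ φ.symm φ.target
  target_eq_prod : ∀ φ ∈ charts, ∃ V W, IsPreconnected V ∧ φ.target = V ×ˢ W
  cover : ∀ a : M, ∃ φ ∈ charts, a ∈ φ.source
  compatible : ∀ φ ∈ charts, ∀ χ ∈ charts, ∀ a ∈ φ.source ∩ χ.source,
    ∃ U ∈ 𝓝 a, ∀ b ∈ U, ∀ c ∈ U, (φ b).2 = (φ c).2 → (χ b).2 = (χ c).2

namespace Foliation

variable {k q : ℕ} {M : Type*} [TopologicalSpace M]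
  [ChartedSpace (EuclideanSpace ℝ (Fin (k + q))) M]

/-- The plaque `{y = const}` of the foliated chart `φ = (x, y)`. -/
def plaque (φ : OpenPartialHomeomorph M (EuclideanSpace ℝ (Fin k) × EuclideanSpace ℝ (Fin q)))
    (y : EuclideanSpace ℝ (Fin q)) : Set M :=
  {a ∈ φ.source | (φ a).2 = y}

/-- The leaf through `a`: all points that can be joined to `a` by a finite chain of plaques. -/
def leaf (F : Foliation k q M) (a : M) : Set M :=
  {b | Relation.ReflTransGen
    (fun c d => ∃ φ ∈ F.charts, ∃ y, c ∈ plaque φ y ∧ d ∈ plaque φ y) a b}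

/-- The family of all leaves. -/
def leaves (F : Foliation k q M) : Set (Set M) := range F.leaf

variable [IsManifold (𝓡 (k + q)) ∞ M] [MeasurableSpace M]

/-- The `k`-dimensional Riemannian volume of the leaf `L` with the metric induced by `g`, as a
measure on `M` concentrated on `L`: its restriction to each plaque contained in `L` is the
volume of that plaque. -/
def leafMeasure (F : Foliation k q M) (g : RiemMetric (k + q) M) (L : Set M) : Measure M :=
  ⨆ φ ∈ F.charts, ⨆ y, ⨆ (_ : plaque φ y ⊆ L),
    parametrizedVolume g (fun x => φ.symm (x, y)) {x | (x, y) ∈ φ.target}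

/-- `P` holds for almost every leaf of the family `𝓛`: the union of the leaves in `𝓛` for which
`P` fails has measure zero in `M`. -/
def AlmostEveryLeaf (g : RiemMetric (k + q) M) (𝓛 : Set (Set M)) (P : Set M → Prop) : Prop :=
  riemannianVolume g (⋃₀ {L ∈ 𝓛 | ¬ P L}) = 0

/-- The class `adm_p(𝓛)` for a family `𝓛` of leaves of `F`. -/
def admissible (F : Foliation k q M) (g : RiemMetric (k + q) M) (p : ℝ≥0∞)
    (𝓛 : Set (Set M)) : Set (M → ℝ) :=
  {f | MemLp f p (riemannianVolume g) ∧ (∀ a, 0 ≤ f a) ∧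
    AlmostEveryLeaf g 𝓛 fun L => 1 ≤ ∫⁻ a, ENNReal.ofReal (f a) ∂(F.leafMeasure g L)}

/-- The `p`-modulus of a family `𝓛` of leaves of `F` (it is `∞` if no function is admissible). -/
def modulus (F : Foliation k q M) (g : RiemMetric (k + q) M) (p : ℝ≥0∞)
    (𝓛 : Set (Set M)) : ℝ≥0∞ :=
  ⨅ f ∈ F.admissible g p 𝓛, eLpNorm f p (riemannianVolume g)

/-- `f₀` is an extremal function for the `p`-modulus of `F`. -/
def IsExtremal (F : Foliation k q M) (g : RiemMetric (k + q) M) (p : ℝ≥0∞) (f₀ : M → ℝ) : Prop :=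
  f₀ ∈ F.admissible g p F.leaves ∧ F.modulus g p F.leaves = eLpNorm f₀ p (riemannianVolume g)

end Foliation

end

/-!
Two facts about a foliation and its leaf volumes carry the proof.

*Null sets.* A set of volume zero in `M` meets almost every leaf in a set of leaf volume zero
(`riemannianVolume_setOf_leafMeasure_ne_zero`). In a foliated chart the Riemannian volume has the
null sets of Lebesgue measure on `ℝᵏ × ℝ^q`, so by Fubini's theorem only a null set of plaques is
exceptional. The leaves through these plaques fill a null set, because a leaf is reached from a
plaque by countably many holonomy maps of a countable foliated atlas, and these are smooth maps of
`ℝ^q`, which preserve null sets.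

*Measurability.* For a Borel function `H ≥ 0` the integral of `H` over the leaf through `a` is a
measurable function of `a` (`measurable_lintegral_leafMeasure`). The leaf measure is a countable sum
of non-overlapping plaque volumes (`leafMeasure_leaf`, which rests on the change of variables
formula), the plaques in a leaf form an orbit of countably many measurable maps of the transversal,
and the integral over a plaque depends measurably on the plaque by Tonelli's theorem.

If `f₀` is extremal and a measurable family `𝓛` has modulus zero, then replacing `f₀` on `⋃₀ 𝓛` by
admissible functions of `𝓛` of small norm shows that `f₀` vanishes almost everywhere on `⋃₀ 𝓛`
(`IsExtremal.ae_eq_zero`). Then `f₀` has integral zero on almost every leaf of `𝓛`, which is only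
compatible with admissibility if `⋃₀ 𝓛` is null.

Conversely, `Lᵖ` is uniformly convex for `1 < p < ∞`, so a minimizing sequence `f n` of admissible
functions converges in norm to some `f₀` (`exists_tendsto_of_midpoint_mem`). A leaf on which `f₀`
has integral less than one belongs, for some `j`, to the family of the leaves on which all the
`|f n - f₀|` have integral at least `1 / (j + 1)`. This family has modulus zero and a measurable
union, so by hypothesis the union is null, and `f₀` is admissible (`admissible_of_tendsto`).
-/

noncomputable section

/-! ### Volume densities of parametrizations -/

theorem apply_sum_smul_sum_smul {V ι : Type*} [AddCommGroup V] [Module ℝ V] [TopologicalSpace V]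
    [Fintype ι] (B : V →L[ℝ] V →L[ℝ] ℝ) (d : ι → V) (c c' : ι → ℝ) :
    B (∑ i, c i • d i) (∑ j, c' j • d j) = ∑ i, ∑ j, c i * c' j * B (d i) (d j) := by
  simp only [map_sum, map_smul, sum_apply, smul_apply, smul_eq_mul, Finset.mul_sum]
  rw [Finset.sum_comm]
  refine Finset.sum_congr rfl fun i _ => Finset.sum_congr rfl fun j _ => ?_
  ring

section Density

variable {n : ℕ} {M : Type*} [TopologicalSpace M] [ChartedSpace (EuclideanSpace ℝ (Fin n)) M]

/-- Restricting a map to a slice `y = const` restricts its derivative to the vectors `(v, 0)`. -/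
theorem mfderiv_slice {k q : ℕ}
    {Ψ : EuclideanSpace ℝ (Fin k) × EuclideanSpace ℝ (Fin q) → M}
    {x : EuclideanSpace ℝ (Fin k)} {y : EuclideanSpace ℝ (Fin q)}
    (h : MDifferentiableAt 𝓘(ℝ, EuclideanSpace ℝ (Fin k) × EuclideanSpace ℝ (Fin q)) (𝓡 n)
      Ψ (x, y)) (v : EuclideanSpace ℝ (Fin k)) :
    mfderiv (𝓡 k) (𝓡 n) (fun x => Ψ (x, y)) x v =
      mfderiv 𝓘(ℝ, EuclideanSpace ℝ (Fin k) × EuclideanSpace ℝ (Fin q)) (𝓡 n) Ψ (x, y) (v, 0) := by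
  have hd : HasFDerivAt (fun x : EuclideanSpace ℝ (Fin k) => (x, y))
      (ContinuousLinearMap.inl ℝ (EuclideanSpace ℝ (Fin k)) (EuclideanSpace ℝ (Fin q))) x :=
    hasFDerivAt_prodMk_left x y
  have := mfderiv_comp (I := 𝓡 k)
    (I' := 𝓘(ℝ, EuclideanSpace ℝ (Fin k) × EuclideanSpace ℝ (Fin q))) (I'' := 𝓡 n) x
    (f := fun x : EuclideanSpace ℝ (Fin k) => (x, y)) (g := Ψ) h
    hd.differentiableAt.mdifferentiableAt
  have h2 : mfderiv (𝓡 k) (𝓡 n) (fun x => Ψ (x, y)) x = _ := this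
  rw [h2, hd.hasMFDerivAt.mfderiv]
  rfl

variable [IsManifold (𝓡 n) ∞ M]

/-- The entries of the Gram matrix of a smooth parametrization are continuous, because the metric
is a continuous section of the bundle of bilinear forms. -/
theorem continuousOn_metric_mfderiv {E : Type*} [NormedAddCommGroup E] [NormedSpace ℝ E]
    (g : RiemMetric n M) {Ψ : E → M} {Ω : Set E} (hΩ : IsOpen Ω)
    (hΨ : ContMDiffOn 𝓘(ℝ, E) (𝓡 n) ∞ Ψ Ω) (v w : E) :
    ContinuousOn (fun u => g.inner (Ψ u) (mfderiv 𝓘(ℝ, E) (𝓡 n) Ψ u v)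
      (mfderiv 𝓘(ℝ, E) (𝓡 n) Ψ u w)) Ω := by
  have hsec : ∀ v : E, ContMDiffOn 𝓘(ℝ, E) ((𝓡 n).prod 𝓘(ℝ, EuclideanSpace ℝ (Fin n))) 0
      (fun u => (⟨Ψ u, mfderiv 𝓘(ℝ, E) (𝓡 n) Ψ u v⟩ : TangentBundle (𝓡 n) M)) Ω := by
    intro v
    have h1 : ContMDiffOn 𝓘(ℝ, E).tangent (𝓡 n).tangent 0
        (tangentMapWithin 𝓘(ℝ, E) (𝓡 n) Ψ Ω) (Bundle.TotalSpace.proj ⁻¹' Ω) :=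
      hΨ.contMDiffOn_tangentMapWithin (m := 0) (by simp) hΩ.uniqueMDiffOn
    have h2 : ContMDiff 𝓘(ℝ, E) 𝓘(ℝ, E).tangent 0
        (fun u : E => (⟨u, v⟩ : TangentBundle 𝓘(ℝ, E) E)) := by
      rw [contMDiff_vectorSpace_iff_contDiff (V := fun _ => v)]
      exact contDiff_const
    have h3 := h1.comp h2.contMDiffOn (s := Ω) (fun u hu => hu)
    refine h3.congr fun u hu => ?_
    simp only [Function.comp, tangentMapWithin]
    rw [mfderivWithin_of_isOpen hΩ hu]
  have hΨ0 : ContMDiffOn 𝓘(ℝ, E) (𝓡 n) 0 Ψ Ω := hΨ.of_le (by simp)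
  have hg : ContMDiffOn 𝓘(ℝ, E) ((𝓡 n).prod 𝓘(ℝ, EuclideanSpace ℝ (Fin n) →L[ℝ]
      EuclideanSpace ℝ (Fin n) →L[ℝ] ℝ)) 0 (fun u => Bundle.TotalSpace.mk'
        (EuclideanSpace ℝ (Fin n) →L[ℝ] EuclideanSpace ℝ (Fin n) →L[ℝ] ℝ)
        (E := fun x : M => TangentSpace (𝓡 n) x →L[ℝ] TangentSpace (𝓡 n) x →L[ℝ] ℝ)
        (Ψ u) (g.inner (Ψ u))) Ω :=
    (g.contMDiff.of_le (by simp)).comp_contMDiffOn hΨ0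
  have h := ContMDiffOn.clm_bundle_apply₂ (E₃ := Bundle.Trivial M ℝ) (F₃ := ℝ) hg (hsec v) (hsec w)
  intro u hu
  have h' := h u hu
  rw [Bundle.contMDiffWithinAt_totalSpace] at h'
  exact h'.2.continuousWithinAt

theorem volumeDensity_continuousOn (g : RiemMetric n M) {m : ℕ}
    {ψ : EuclideanSpace ℝ (Fin m) → M} {Ω : Set (EuclideanSpace ℝ (Fin m))} (hΩ : IsOpen Ω)
    (hψ : ContMDiffOn (𝓡 m) (𝓡 n) ∞ ψ Ω) :
    ContinuousOn (volumeDensity g ψ) Ω := by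
  unfold volumeDensity
  refine ENNReal.continuous_ofReal.comp_continuousOn (Real.continuous_sqrt.comp_continuousOn ?_)
  refine Continuous.comp_continuousOn (g := Matrix.det) (continuous_id.matrix_det) ?_
  refine continuousOn_pi.2 fun i => continuousOn_pi.2 fun j => ?_
  exact continuousOn_metric_mfderiv g hΩ hψ _ _

/-- The volume density of the plaques of a chart is continuous in all variables jointly, not only
along each plaque. -/
theorem volumeDensity_slice_continuousOn {k q : ℕ} (g : RiemMetric n M)
    {Ψ : EuclideanSpace ℝ (Fin k) × EuclideanSpace ℝ (Fin q) → M}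
    {Ω : Set (EuclideanSpace ℝ (Fin k) × EuclideanSpace ℝ (Fin q))} (hΩ : IsOpen Ω)
    (hΨ : ContMDiffOn 𝓘(ℝ, EuclideanSpace ℝ (Fin k) × EuclideanSpace ℝ (Fin q)) (𝓡 n) ∞ Ψ Ω) :
    ContinuousOn (fun u : EuclideanSpace ℝ (Fin k) × EuclideanSpace ℝ (Fin q) =>
      volumeDensity g (fun x => Ψ (x, u.2)) u.1) Ω := by
  unfold volumeDensity
  refine ENNReal.continuous_ofReal.comp_continuousOn (Real.continuous_sqrt.comp_continuousOn ?_)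
  refine Continuous.comp_continuousOn (g := Matrix.det) (continuous_id.matrix_det) ?_
  refine continuousOn_pi.2 fun i => continuousOn_pi.2 fun j => ?_
  refine (continuousOn_metric_mfderiv g hΩ hΨ (EuclideanSpace.single i 1, 0)
    (EuclideanSpace.single j 1, 0)).congr fun u hu => ?_
  have hd : MDifferentiableAt 𝓘(ℝ, EuclideanSpace ℝ (Fin k) × EuclideanSpace ℝ (Fin q)) (𝓡 n)
      Ψ (u.1, u.2) := (hΨ.contMDiffAt (hΩ.mem_nhds hu)).mdifferentiableAt (by simp)
  simp only [Matrix.of_apply]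
  rw [mfderiv_slice hd, mfderiv_slice hd]

/-- The Gram matrix of linearly independent tangent vectors is positive definite. -/
theorem volumeDensity_ne_zero (g : RiemMetric n M) {m : ℕ}
    {ψ : EuclideanSpace ℝ (Fin m) → M} {u : EuclideanSpace ℝ (Fin m)}
    (h : Function.Injective (mfderiv (𝓡 m) (𝓡 n) ψ u)) : volumeDensity g ψ u ≠ 0 := by
  set D : EuclideanSpace ℝ (Fin m) →L[ℝ] TangentSpace (𝓡 n) (ψ u) :=
    mfderiv (𝓡 m) (𝓡 n) ψ u with hD
  set A : Matrix (Fin m) (Fin m) ℝ := Matrix.of fun i j : Fin m =>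
    g.inner (ψ u) (D (EuclideanSpace.single i (1 : ℝ))) (D (EuclideanSpace.single j (1 : ℝ)))
    with hA
  have hsum : ∀ c : Fin m → ℝ, D (WithLp.toLp 2 c) =
      ∑ i, c i • D (EuclideanSpace.single i (1 : ℝ)) := by
    intro c
    have : WithLp.toLp 2 c = ∑ i, c i • EuclideanSpace.single i (1 : ℝ) := by
      ext j
      simp [Finset.sum_apply, Pi.single_apply]
    rw [this, map_sum]
    simp only [map_smul]
  have hpos : A.PosDef := by
    refine Matrix.PosDef.of_dotProduct_mulVec_pos ?_ fun c hc => ?_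
    · ext i j
      simp [hA, Matrix.conjTranspose_apply, g.symm]
    · have hne : D (WithLp.toLp 2 c) ≠ 0 := by
        intro h0
        apply hc
        have : WithLp.toLp 2 c = (0 : EuclideanSpace ℝ (Fin m)) := h (h0.trans (map_zero D).symm)
        simpa using congrArg (WithLp.ofLp) this
      have := g.pos (ψ u) _ hne
      rw [hsum, apply_sum_smul_sum_smul] at this
      refine this.trans_eq ?_
      simp only [dotProduct, Matrix.mulVec, star_trivial, hA, Matrix.of_apply, Finset.mul_sum]
      refine Finset.sum_congr rfl fun i _ => Finset.sum_congr rfl fun j _ => ?_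
      ring
  have : 0 < Real.sqrt A.det := Real.sqrt_pos.2 hpos.det_pos
  exact (ENNReal.ofReal_pos.2 this).ne'

/-- Transformation of the volume density under a change of parameters. -/
theorem volumeDensity_comp (g : RiemMetric n M) {m : ℕ}
    {ψ χ : EuclideanSpace ℝ (Fin m) → M} {σ : EuclideanSpace ℝ (Fin m) → EuclideanSpace ℝ (Fin m)}
    {u : EuclideanSpace ℝ (Fin m)} (h : ψ =ᶠ[𝓝 u] χ ∘ σ) (hσ : DifferentiableAt ℝ σ u)
    (hχ : MDifferentiableAt (𝓡 m) (𝓡 n) χ (σ u)) :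
    volumeDensity g ψ u =
      ENNReal.ofReal |(fderiv ℝ σ u).det| * volumeDensity g χ (σ u) := by
  have hu : ψ u = χ (σ u) := h.eq_of_nhds
  set D : EuclideanSpace ℝ (Fin m) →L[ℝ] TangentSpace (𝓡 n) (χ (σ u)) :=
    mfderiv (𝓡 m) (𝓡 n) χ (σ u) with hD
  set J : Matrix (Fin m) (Fin m) ℝ :=
    LinearMap.toMatrix (EuclideanSpace.basisFun (Fin m) ℝ).toBasis
      (EuclideanSpace.basisFun (Fin m) ℝ).toBasis (fderiv ℝ σ u).toLinearMap with hJ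
  have hdet : (fderiv ℝ σ u).det = J.det := by
    rw [hJ, LinearMap.det_toMatrix]
  set A : Matrix (Fin m) (Fin m) ℝ := Matrix.of fun i j : Fin m =>
    g.inner (χ (σ u)) (D (EuclideanSpace.single i (1 : ℝ))) (D (EuclideanSpace.single j (1 : ℝ)))
    with hA
  have hmf : mfderiv (𝓡 m) (𝓡 n) (χ ∘ σ) u = D.comp (fderiv ℝ σ u) := by
    rw [mfderiv_comp (I' := 𝓡 m) u hχ hσ.mdifferentiableAt, mfderiv_eq_fderiv, hD]
    rfl
  have hcol : ∀ i, fderiv ℝ σ u (EuclideanSpace.single i (1 : ℝ)) =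
      ∑ k, J k i • EuclideanSpace.single k (1 : ℝ) := by
    intro i
    ext j
    simp [hJ, LinearMap.toMatrix_apply, Pi.single_apply]
  have hmat : (Matrix.of fun i j : Fin m => g.inner (ψ u)
      (mfderiv (𝓡 m) (𝓡 n) ψ u (EuclideanSpace.single i (1 : ℝ)))
      (mfderiv (𝓡 m) (𝓡 n) ψ u (EuclideanSpace.single j (1 : ℝ)))) = J.transpose * A * J := by
    ext i j
    have h1 : ∀ v w : EuclideanSpace ℝ (Fin m), g.inner (ψ u) (mfderiv (𝓡 m) (𝓡 n) ψ u v)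
        (mfderiv (𝓡 m) (𝓡 n) ψ u w) =
        g.inner (χ (σ u)) (D (fderiv ℝ σ u v)) (D (fderiv ℝ σ u w)) := by
      intro v w
      -- the two sides live in the tangent spaces at `ψ u` and at `χ (σ u)`, which are equal points
      have h2 : ∀ v : EuclideanSpace ℝ (Fin m),
          HEq (mfderiv (𝓡 m) (𝓡 n) ψ u v) (D (fderiv ℝ σ u v)) := by
        intro v
        have h3 : mfderiv (𝓡 m) (𝓡 n) ψ u = mfderiv (𝓡 m) (𝓡 n) (χ ∘ σ) u := h.mfderiv_eq
        rw [h3, hmf]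
        rfl
      have hv := h2 v
      have hw := h2 w
      revert hv hw
      generalize mfderiv (𝓡 m) (𝓡 n) ψ u v = a
      generalize mfderiv (𝓡 m) (𝓡 n) ψ u w = b
      revert a b
      rw [hu]
      rintro a b h1 h2
      rw [eq_of_heq h1, eq_of_heq h2]
    have hD' : ∀ i, D (fderiv ℝ σ u (EuclideanSpace.single i (1 : ℝ))) =
        ∑ k, J k i • D (EuclideanSpace.single k (1 : ℝ)) := by
      intro i
      rw [hcol, map_sum]
      simp only [map_smul]
    rw [Matrix.of_apply, h1, hD', hD', apply_sum_smul_sum_smul]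
    simp only [Matrix.mul_apply, Matrix.transpose_apply, hA, Matrix.of_apply, Finset.sum_mul]
    rw [Finset.sum_comm]
    refine Finset.sum_congr rfl fun a _ => Finset.sum_congr rfl fun b _ => ?_
    ring
  unfold volumeDensity
  rw [hmat, Matrix.det_mul, Matrix.det_mul, Matrix.det_transpose, hdet,
    ← ENNReal.ofReal_mul (abs_nonneg _)]
  congr 1
  rw [show J.det * A.det * J.det = J.det ^ 2 * A.det by ring, Real.sqrt_mul (sq_nonneg _),
    Real.sqrt_sq_eq_abs]
  rfl

end Density

/-! ### Null sets of the Riemannian volume -/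

theorem measurableSet_inter_preimage_of_continuousOn {α β : Type*} [TopologicalSpace α]
    [TopologicalSpace β] [MeasurableSpace α] [MeasurableSpace β] [OpensMeasurableSpace α]
    [BorelSpace β] {f : α → β} {V : Set α} (hV : MeasurableSet V) (hf : ContinuousOn f V)
    {s : Set β} (hs : MeasurableSet s) : MeasurableSet (V ∩ f ⁻¹' s) := by
  have h1 : Measurable (V.domRestrict f) :=
    (continuousOn_iff_continuous_domRestrict.1 hf).measurable
  have h2 := hV.subtype_image (h1 hs)
  convert h2 using 1
  ext x
  simp [and_comm]

/-- A measurable set that is null for every measure of a family, countable or not, is null for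
their supremum: the restriction of the supremum to the complement is already an upper bound. -/
theorem iSup_measure_apply_eq_zero {α : Type*} [MeasurableSpace α] {ι : Sort*} {m : ι → Measure α}
    {N : Set α} (hN : MeasurableSet N) (h : ∀ i, m i N = 0) : (⨆ i, m i) N = 0 := by
  have hle : (⨆ i, m i) ≤ (⨆ i, m i).restrict Nᶜ := by
    refine iSup_le fun i => ?_
    rw [← Measure.restrict_eq_self_of_ae_mem (s := Nᶜ) (μ := m i)]
    · exact Measure.restrict_mono le_rfl (le_iSup m i)
    · exact measure_eq_zero_iff_ae_notMem.1 (h i)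
  have := hle N
  rw [Measure.restrict_apply hN] at this
  simpa using this

/-- A differentiable map between vector spaces of the same dimension preserves null sets. -/
theorem addHaar_image_eq_zero_of_finrank_eq {E F : Type*} [NormedAddCommGroup E] [NormedSpace ℝ E]
    [FiniteDimensional ℝ E] [MeasurableSpace E] [BorelSpace E] [NormedAddCommGroup F]
    [NormedSpace ℝ F] [FiniteDimensional ℝ F] [MeasurableSpace F] [BorelSpace F]
    (μ : Measure E) [μ.IsAddHaarMeasure] (ν : Measure F) [ν.IsAddHaarMeasure]
    (hdim : Module.finrank ℝ E = Module.finrank ℝ F) {f : E → F} {s : Set E}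
    (hf : DifferentiableOn ℝ f s) (hs : μ s = 0) : ν (f '' s) = 0 := by
  let L : F ≃L[ℝ] E := ContinuousLinearEquiv.ofFinrankEq hdim.symm
  have h1 : μ ((L ∘ f) '' s) = 0 :=
    addHaar_image_eq_zero_of_differentiableOn_of_addHaar_eq_zero μ
      (L.differentiable.comp_differentiableOn hf) hs
  have : (μ.map L.symm).IsAddHaarMeasure := L.symm.isAddHaarMeasure_map μ
  refine Measure.absolutelyContinuous_isAddHaarMeasure ν (μ.map L.symm) ?_
  have hm : MeasurableEmbedding L.symm := L.symm.toHomeomorph.measurableEmbedding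
  rw [hm.map_apply]
  rw [image_comp] at h1
  rwa [← L.image_eq_preimage_symm]

section ParametrizedVolume

variable {n : ℕ} {M : Type*} [TopologicalSpace M] [ChartedSpace (EuclideanSpace ℝ (Fin n)) M]
  [IsManifold (𝓡 n) ∞ M] [MeasurableSpace M] [BorelSpace M]

theorem lintegral_parametrizedVolume (g : RiemMetric n M) {m : ℕ}
    {ψ : EuclideanSpace ℝ (Fin m) → M} {V : Set (EuclideanSpace ℝ (Fin m))} (hV : IsOpen V)
    (hψ : ContMDiffOn (𝓡 m) (𝓡 n) ∞ ψ V) {H : M → ℝ≥0∞} (hH : Measurable H) :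
    ∫⁻ a, H a ∂(parametrizedVolume g ψ V) = ∫⁻ x in V, volumeDensity g ψ x * H (ψ x) := by
  have h1 : AEMeasurable ψ (volume.restrict V) := hψ.continuousOn.aemeasurable hV.measurableSet
  have h2 : AEMeasurable (volumeDensity g ψ) (volume.restrict V) :=
    (volumeDensity_continuousOn g hV hψ).aemeasurable hV.measurableSet
  have h3 : AEMeasurable ψ ((volume.restrict V).withDensity (volumeDensity g ψ)) :=
    h1.mono_ac (withDensity_absolutelyContinuous _ _)
  rw [parametrizedVolume, lintegral_map' hH.aemeasurable h3,
    lintegral_withDensity_eq_lintegral_mul₀ h2 (g := fun x => H (ψ x)) (hH.comp_aemeasurable h1)]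
  rfl

theorem parametrizedVolume_apply (g : RiemMetric n M) {m : ℕ}
    {ψ : EuclideanSpace ℝ (Fin m) → M} {V : Set (EuclideanSpace ℝ (Fin m))} (hV : IsOpen V)
    (hψ : ContMDiffOn (𝓡 m) (𝓡 n) ∞ ψ V) {s : Set M} (hs : MeasurableSet s) :
    parametrizedVolume g ψ V s = ∫⁻ x in V ∩ ψ ⁻¹' s, volumeDensity g ψ x := by
  have hm := measurableSet_inter_preimage_of_continuousOn hV.measurableSet hψ.continuousOn hs
  rw [← lintegral_indicator_one hs, lintegral_parametrizedVolume g hV hψ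
    (measurable_one.indicator hs), ← lintegral_indicator hm, ← lintegral_indicator hV.measurableSet]
  congr 1
  ext x
  by_cases hx : x ∈ V <;> by_cases hx' : ψ x ∈ s <;> simp [hx, hx']

theorem parametrizedVolume_apply_eq_zero (g : RiemMetric n M) {m : ℕ}
    {ψ : EuclideanSpace ℝ (Fin m) → M} {V : Set (EuclideanSpace ℝ (Fin m))} (hV : IsOpen V)
    (hψ : ContMDiffOn (𝓡 m) (𝓡 n) ∞ ψ V) {s : Set M} (hs : MeasurableSet s)
    (h : volume (V ∩ ψ ⁻¹' s) = 0) : parametrizedVolume g ψ V s = 0 := by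
  rw [parametrizedVolume_apply g hV hψ hs, Measure.restrict_eq_zero.2 h, lintegral_zero_measure]

/-- As the volume density of an immersion does not vanish, null sets for the parametrized volume are
Lebesgue null in the parameters. -/
theorem volume_inter_preimage_eq_zero (g : RiemMetric n M) {m : ℕ}
    {ψ : EuclideanSpace ℝ (Fin m) → M} {V : Set (EuclideanSpace ℝ (Fin m))} (hV : IsOpen V)
    (hψ : ContMDiffOn (𝓡 m) (𝓡 n) ∞ ψ V)
    (hinj : ∀ x ∈ V, Function.Injective (mfderiv (𝓡 m) (𝓡 n) ψ x)) {s : Set M}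
    (hs : MeasurableSet s) (h : parametrizedVolume g ψ V s = 0) : volume (V ∩ ψ ⁻¹' s) = 0 := by
  have hm := measurableSet_inter_preimage_of_continuousOn hV.measurableSet hψ.continuousOn hs
  have hc := (volumeDensity_continuousOn g hV hψ).mono (inter_subset_left (t := ψ ⁻¹' s))
  rw [parametrizedVolume_apply g hV hψ hs, lintegral_eq_zero_iff' (hc.aemeasurable hm),
    Filter.EventuallyEq, ae_restrict_iff' hm] at h
  refine measure_mono_null (fun x hx => ?_) (ae_iff.1 h)
  simpa [hx.1, show ψ x ∈ s from hx.2] using volumeDensity_ne_zero g (hinj x hx.1)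

end ParametrizedVolume

section RiemannianVolumeNull

variable {n : ℕ} {M : Type*} [TopologicalSpace M] [ChartedSpace (EuclideanSpace ℝ (Fin n)) M]
  [IsManifold (𝓡 n) ∞ M]

theorem contMDiffOn_of_mem_atlas {c : OpenPartialHomeomorph M (EuclideanSpace ℝ (Fin n))}
    (hc : c ∈ atlas (EuclideanSpace ℝ (Fin n)) M) : ContMDiffOn (𝓡 n) (𝓡 n) ∞ c c.source :=
  contMDiffOn_of_mem_maximalAtlas (IsManifold.subset_maximalAtlas hc)

theorem contMDiffOn_symm_of_mem_atlas {c : OpenPartialHomeomorph M (EuclideanSpace ℝ (Fin n))}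
    (hc : c ∈ atlas (EuclideanSpace ℝ (Fin n)) M) : ContMDiffOn (𝓡 n) (𝓡 n) ∞ c.symm c.target :=
  contMDiffOn_symm_of_mem_maximalAtlas (IsManifold.subset_maximalAtlas hc)

variable [MeasurableSpace M] [BorelSpace M]
  {F : Type*} [NormedAddCommGroup F] [NormedSpace ℝ F] [FiniteDimensional ℝ F]
  [MeasurableSpace F] [BorelSpace F]

/-- A set that is null for the Riemannian volume is Lebesgue null in every smooth chart, with
values in any `n`-dimensional vector space. -/
theorem addHaar_chart_eq_zero_of_riemannianVolume_eq_zero [SecondCountableTopology M]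
    (g : RiemMetric n M) (ν : Measure F) [ν.IsAddHaarMeasure] (hF : Module.finrank ℝ F = n)
    (φ : OpenPartialHomeomorph M F) (hφ : ContMDiffOn (𝓡 n) 𝓘(ℝ, F) ∞ φ φ.source)
    {N : Set M} (hN : MeasurableSet N) (h : riemannianVolume g N = 0) :
    ν (φ.target ∩ φ.symm ⁻¹' N) = 0 := by
  obtain ⟨s, hs, hsU⟩ := TopologicalSpace.countable_cover_nhds
    (f := fun a : M => (chartAt (EuclideanSpace ℝ (Fin n)) a).source)
    (fun a => chart_source_mem_nhds _ a)
  let c := fun a : M => chartAt (EuclideanSpace ℝ (Fin n)) a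
  let S := fun a : M => (c a).target ∩ (c a).symm ⁻¹' (N ∩ φ.source)
  have hsub : φ.target ∩ φ.symm ⁻¹' N ⊆ ⋃ a ∈ s, (φ ∘ (c a).symm) '' S a := by
    rintro z ⟨hz, hzN⟩
    have : φ.symm z ∈ ⋃ a ∈ s, (c a).source := hsU ▸ mem_univ _
    simp only [mem_iUnion] at this ⊢
    obtain ⟨a, ha, hza⟩ := this
    refine ⟨a, ha, c a (φ.symm z), ⟨(c a).map_source hza, ?_⟩, ?_⟩
    · rw [mem_preimage, (c a).left_inv hza]
      exact ⟨hzN, φ.map_target hz⟩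
    · simp [(c a).left_inv hza, φ.right_inv hz]
  refine measure_mono_null hsub ((measure_biUnion_null_iff hs).2 fun a _ => ?_)
  have hca : c a ∈ atlas (EuclideanSpace ℝ (Fin n)) M := chart_mem_atlas _ a
  refine addHaar_image_eq_zero_of_finrank_eq (volume : Measure (EuclideanSpace ℝ (Fin n))) ν
    (by simp [hF]) ?_ ?_
  · have : ContMDiffOn (𝓡 n) 𝓘(ℝ, F) ∞ (φ ∘ (c a).symm) (S a) :=
      hφ.comp ((contMDiffOn_symm_of_mem_atlas hca).mono inter_subset_left) fun x hx => hx.2.2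
    exact (contMDiffOn_iff_contDiffOn.1 this).differentiableOn (by simp)
  · refine measure_mono_null (inter_subset_inter_right _ (preimage_mono inter_subset_left))
      (volume_inter_preimage_eq_zero g (c a).open_target (contMDiffOn_symm_of_mem_atlas hca)
      (fun x hx => (mdifferentiable_of_mem_atlas hca).symm.mfderiv_injective hx) hN ?_)
    exact nonpos_iff_eq_zero.1 (h ▸ le_iSup₂
      (f := fun φ (_ : φ ∈ atlas (EuclideanSpace ℝ (Fin n)) M) =>
        parametrizedVolume g φ.symm φ.target) (c a) hca N)

/-- A measurable set that is covered by countably many smooth charts, and is Lebesgue null in each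
of them, is null for the Riemannian volume. -/
theorem riemannianVolume_eq_zero_of_addHaar_chart_eq_zero {ι : Type*} [Countable ι]
    (g : RiemMetric n M) (ν : Measure F) [ν.IsAddHaarMeasure] (hF : Module.finrank ℝ F = n)
    (φ : ι → OpenPartialHomeomorph M F)
    (hφ : ∀ i, ContMDiffOn 𝓘(ℝ, F) (𝓡 n) ∞ (φ i).symm (φ i).target)
    {N : Set M} (hN : MeasurableSet N) (hcover : ∀ a ∈ N, ∃ i, a ∈ (φ i).source)
    (h : ∀ i, ν ((φ i).target ∩ (φ i).symm ⁻¹' N) = 0) :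
    riemannianVolume g N = 0 := by
  refine iSup_measure_apply_eq_zero hN fun c => iSup_measure_apply_eq_zero hN fun hc => ?_
  refine parametrizedVolume_apply_eq_zero g c.open_target (contMDiffOn_symm_of_mem_atlas hc) hN ?_
  let S := fun i => (φ i).target ∩ (φ i).symm ⁻¹' (N ∩ c.source)
  have hsub : c.target ∩ c.symm ⁻¹' N ⊆ ⋃ i, (c ∘ (φ i).symm) '' S i := by
    rintro z ⟨hz, hzN⟩
    obtain ⟨i, hi⟩ := hcover (c.symm z) hzN
    refine mem_iUnion.2 ⟨i, φ i (c.symm z), ⟨(φ i).map_source hi, ?_⟩, ?_⟩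
    · rw [mem_preimage, (φ i).left_inv hi]
      exact ⟨hzN, c.map_target hz⟩
    · simp [(φ i).left_inv hi, c.right_inv hz]
  refine measure_mono_null hsub (measure_iUnion_null fun i => ?_)
  refine addHaar_image_eq_zero_of_finrank_eq ν (volume : Measure (EuclideanSpace ℝ (Fin n)))
    (by simp [hF]) ?_
    (measure_mono_null (inter_subset_inter_right _ (preimage_mono inter_subset_left)) (h i))
  have : ContMDiffOn 𝓘(ℝ, F) (𝓡 n) ∞ (c ∘ (φ i).symm) (S i) :=
    (contMDiffOn_of_mem_atlas hc).comp ((hφ i).mono inter_subset_left) fun x hx => hx.2.2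
  exact (contMDiffOn_iff_contDiffOn.1 this).differentiableOn (by simp)

end RiemannianVolumeNull

/-! ### Countable foliated atlases and the holonomy of their transversals -/

namespace Foliation

variable {k q : ℕ} {M : Type*} [TopologicalSpace M]
  [ChartedSpace (EuclideanSpace ℝ (Fin (k + q))) M]

theorem mem_leaf_self (F : Foliation k q M) (a : M) : a ∈ F.leaf a := Relation.ReflTransGen.refl

theorem mem_leaf_of_mem_plaque (F : Foliation k q M) {a b c : M} (hb : b ∈ F.leaf a)
    {φ : OpenPartialHomeomorph M (EuclideanSpace ℝ (Fin k) × EuclideanSpace ℝ (Fin q))}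
    (hφ : φ ∈ F.charts) {y : EuclideanSpace ℝ (Fin q)} (hby : b ∈ plaque φ y)
    (hcy : c ∈ plaque φ y) : c ∈ F.leaf a :=
  Relation.ReflTransGen.tail hb ⟨φ, hφ, y, hby, hcy⟩

theorem mem_leaf_symm (F : Foliation k q M) {a b : M} (h : b ∈ F.leaf a) : a ∈ F.leaf b := by
  have : Std.Symm fun c d : M => ∃ φ ∈ F.charts, ∃ y, c ∈ plaque φ y ∧ d ∈ plaque φ y :=
    ⟨fun _ _ ⟨φ, hφ, y, hc, hd⟩ => ⟨φ, hφ, y, hd, hc⟩⟩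
  exact Relation.ReflTransGen.stdSymm.symm _ _ h

theorem leaf_eq_of_mem (F : Foliation k q M) {a b : M} (h : b ∈ F.leaf a) :
    F.leaf b = F.leaf a :=
  Set.ext fun _ => ⟨fun hc => Relation.ReflTransGen.trans h hc,
    fun hc => Relation.ReflTransGen.trans (F.mem_leaf_symm h) hc⟩

/-- A countable cover of the manifold by foliated charts of `F`. -/
structure CountableAtlas (F : Foliation k q M) where
  chart : ℕ → OpenPartialHomeomorph M (EuclideanSpace ℝ (Fin k) × EuclideanSpace ℝ (Fin q))
  mem_charts : ∀ i, chart i ∈ F.charts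
  cover : ∀ a, ∃ i, a ∈ (chart i).source

theorem nonempty_countableAtlas [Nonempty M] [SecondCountableTopology M] (F : Foliation k q M) :
    Nonempty F.CountableAtlas := by
  choose φ hφ hmem using F.cover
  obtain ⟨s, hs, hsU⟩ := TopologicalSpace.countable_cover_nhds
    (f := fun a : M => (φ a).source) (fun a => (φ a).open_source.mem_nhds (hmem a))
  have hne : s.Nonempty := by
    obtain ⟨a⟩ := ‹Nonempty M›
    have : a ∈ ⋃ b ∈ s, (φ b).source := hsU ▸ mem_univ a
    simp only [mem_iUnion] at this
    exact ⟨this.choose, this.choose_spec.choose⟩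
  obtain ⟨u, rfl⟩ := hs.exists_eq_range hne
  refine ⟨⟨fun i => φ (u i), fun i => hφ _, fun a => ?_⟩⟩
  have : a ∈ ⋃ b ∈ range u, (φ b).source := hsU ▸ mem_univ a
  simpa using this

/-- Plaques are connected, being homeomorphic to the first factor of the product that is the range
of their chart. -/
theorem isPreconnected_plaque (F : Foliation k q M) {φ : OpenPartialHomeomorph M
    (EuclideanSpace ℝ (Fin k) × EuclideanSpace ℝ (Fin q))} (hφ : φ ∈ F.charts)
    (y : EuclideanSpace ℝ (Fin q)) : IsPreconnected (plaque φ y) := by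
  obtain ⟨V, W, hV, hVW⟩ := F.target_eq_prod φ hφ
  by_cases hy : y ∈ W
  · have : plaque φ y = φ.symm '' ((fun x => (x, y)) '' V) := by
      ext a
      constructor
      · rintro ⟨ha, rfl⟩
        have := φ.map_source ha
        rw [hVW] at this
        exact ⟨φ a, ⟨(φ a).1, this.1, rfl⟩, φ.left_inv ha⟩
      · rintro ⟨_, ⟨x, hx, rfl⟩, rfl⟩
        have : (x, y) ∈ φ.target := hVW ▸ mk_mem_prod hx hy
        exact ⟨φ.map_target this, by rw [φ.right_inv this]⟩
    rw [this]
    refine (hV.image _ (by fun_prop)).image _ (φ.symm.continuousOn.mono ?_)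
    rintro _ ⟨x, hx, rfl⟩
    have : (x, y) ∈ φ.target := hVW ▸ mk_mem_prod hx hy
    exact this
  · have : plaque φ y = ∅ := by
      ext a
      simp only [mem_empty_iff_false, iff_false]
      rintro ⟨ha, rfl⟩
      have := φ.map_source ha
      rw [hVW] at this
      exact hy this.2
    rw [this]
    exact isPreconnected_empty

namespace CountableAtlas

variable {F : Foliation k q M} (A : F.CountableAtlas)

/-- The transverse coordinate of the `i`-th chart; the plaques are its fibres. -/
def proj (i : ℕ) (a : M) : EuclideanSpace ℝ (Fin q) := (A.chart i a).2

theorem proj_continuousOn (i : ℕ) : ContinuousOn (A.proj i) (A.chart i).source :=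
  continuous_snd.comp_continuousOn (A.chart i).continuousOn

/-- The index of the first chart of the atlas around a point. -/
def index (a : M) : ℕ := by
  classical
  exact Nat.find (A.cover a)

theorem mem_source_index (a : M) : a ∈ (A.chart (A.index a)).source := by
  classical
  exact Nat.find_spec (A.cover a)

theorem setOf_index_eq (i : ℕ) :
    {a | A.index a = i} = (A.chart i).source \ ⋃ j ∈ Iio i, (A.chart j).source := by
  classical
  ext a
  simp only [index, mem_ofPred_eq, Nat.find_eq_iff, mem_sdiff, mem_iUnion, mem_Iio, not_exists]

/-- The point of the total transversal `ℕ × ℝ^q` (one copy of the transverse coordinate space for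
each chart of the atlas) that a point of `M` projects to, in the first chart around it. -/
def toTransversal (a : M) : ℕ × EuclideanSpace ℝ (Fin q) := (A.index a, A.proj (A.index a) a)

variable [SecondCountableTopology M]

/-- The index set of the elementary holonomy maps of the atlas: two charts and a small open set. -/
abbrev TransitionIndex (M : Type*) [TopologicalSpace M] [SecondCountableTopology M] : Type _ :=
  ℕ × ℕ × TopologicalSpace.countableBasis M

/-- On the open set `e.2.2`, the transverse coordinate of the chart `e.2.1` is a function of the
transverse coordinate of the chart `e.1`. -/
structure IsTransition (e : TransitionIndex M) : Prop where
  subset_left : (e.2.2 : Set M) ⊆ (A.chart e.1).source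
  subset_right : (e.2.2 : Set M) ⊆ (A.chart e.2.1).source
  proj_eq : ∀ b ∈ (e.2.2 : Set M), ∀ c ∈ (e.2.2 : Set M),
    A.proj e.1 b = A.proj e.1 c → A.proj e.2.1 b = A.proj e.2.1 c

theorem exists_isTransition {i j : ℕ} {a : M} (hi : a ∈ (A.chart i).source)
    (hj : a ∈ (A.chart j).source) :
    ∃ U : TopologicalSpace.countableBasis M, A.IsTransition (i, j, U) ∧ a ∈ (U : Set M) := by
  obtain ⟨U, hU, h⟩ := F.compatible _ (A.mem_charts i) _ (A.mem_charts j) a ⟨hi, hj⟩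
  obtain ⟨B, hB, haB, hBU⟩ := (TopologicalSpace.isBasis_countableBasis M).mem_nhds_iff.1
    (Filter.inter_mem hU (((A.chart i).open_source.inter (A.chart j).open_source).mem_nhds
      ⟨hi, hj⟩))
  exact ⟨⟨B, hB⟩, ⟨fun b hb => (hBU hb).2.1, fun b hb => (hBU hb).2.2,
    fun b hb c hc => h b (hBU hb).1 c (hBU hc).1⟩, haB⟩

open Classical in
/-- The elementary holonomy map of a transition. It is extended by the identity to the whole
transversal, so that compositions are defined everywhere and stay in the orbit. -/
def holonomy (e : TransitionIndex M) (t : ℕ × EuclideanSpace ℝ (Fin q)) :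
    ℕ × EuclideanSpace ℝ (Fin q) :=
  if h : A.IsTransition e ∧ t.1 = e.1 ∧ t.2 ∈ A.proj e.1 '' e.2.2 then
    (e.2.1, A.proj e.2.1 h.2.2.choose) else t

variable {A} in
theorem IsTransition.holonomy_apply {e : TransitionIndex M} (he : A.IsTransition e) {a : M}
    (ha : a ∈ (e.2.2 : Set M)) :
    A.holonomy e (e.1, A.proj e.1 a) = (e.2.1, A.proj e.2.1 a) := by
  have h : A.IsTransition e ∧ (e.1, A.proj e.1 a).1 = e.1 ∧
    (e.1, A.proj e.1 a).2 ∈ A.proj e.1 '' e.2.2 := ⟨he, rfl, mem_image_of_mem _ ha⟩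
  rw [holonomy, dif_pos h]
  exact Prod.ext rfl (he.proj_eq _ h.2.2.choose_spec.1 _ ha h.2.2.choose_spec.2)

theorem holonomy_of_not {e : TransitionIndex M} {t : ℕ × EuclideanSpace ℝ (Fin q)}
    (h : ¬ (A.IsTransition e ∧ t.1 = e.1 ∧ t.2 ∈ A.proj e.1 '' e.2.2)) : A.holonomy e t = t :=
  dif_neg h

/-- The composition of a word of elementary holonomy maps. -/
def word (w : List (TransitionIndex M)) (t : ℕ × EuclideanSpace ℝ (Fin q)) :
    ℕ × EuclideanSpace ℝ (Fin q) := w.foldr A.holonomy t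

/-- The orbit of a point of the transversal under the holonomy maps: the plaques of the atlas in
one leaf. -/
def orbit (t : ℕ × EuclideanSpace ℝ (Fin q)) : Set (ℕ × EuclideanSpace ℝ (Fin q)) :=
  range fun w => A.word w t

theorem countable_orbit (t : ℕ × EuclideanSpace ℝ (Fin q)) : (A.orbit t).Countable := by
  have : Countable (TopologicalSpace.countableBasis M) :=
    (TopologicalSpace.countable_countableBasis M).to_subtype
  exact countable_range _

theorem orbit_trans {t u v : ℕ × EuclideanSpace ℝ (Fin q)} (h : u ∈ A.orbit t)
    (h' : v ∈ A.orbit u) : v ∈ A.orbit t := by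
  obtain ⟨w, rfl⟩ := h
  obtain ⟨w', rfl⟩ := h'
  exact ⟨w' ++ w, by simp [word, List.foldr_append]⟩

theorem proj_mem_orbit_proj {i j : ℕ} {a : M} (hi : a ∈ (A.chart i).source)
    (hj : a ∈ (A.chart j).source) : (j, A.proj j a) ∈ A.orbit (i, A.proj i a) := by
  obtain ⟨U, hU, ha⟩ := A.exists_isTransition hi hj
  exact ⟨[(i, j, U)], hU.holonomy_apply ha⟩

/-- The plaques of the atlas through `a` and through `b` are in the same holonomy orbit. -/
def Joined (a b : M) : Prop :=
  ∀ i j, a ∈ (A.chart i).source → b ∈ (A.chart j).source →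
    (j, A.proj j b) ∈ A.orbit (i, A.proj i a)

theorem Joined.trans {a b c : M} (h : A.Joined a b) (h' : A.Joined b c) : A.Joined a c := by
  intro i j hi hj
  obtain ⟨l, hl⟩ := A.cover b
  exact A.orbit_trans (h i l hi hl) (h' l j hl hj)

theorem joined_of_proj_eq {a b : M} {l : ℕ} (ha : a ∈ (A.chart l).source)
    (hb : b ∈ (A.chart l).source) (h : A.proj l a = A.proj l b) : A.Joined a b := by
  intro i j hi hj
  have h1 := A.proj_mem_orbit_proj hi ha
  rw [h] at h1
  exact A.orbit_trans h1 (A.proj_mem_orbit_proj hb hj)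

/-- Points of one plaque of an arbitrary foliated chart are joined by plaques of the countable
atlas. This is where the connectedness of plaques enters. -/
theorem joined_of_mem_plaque {φ : OpenPartialHomeomorph M
    (EuclideanSpace ℝ (Fin k) × EuclideanSpace ℝ (Fin q))} (hφ : φ ∈ F.charts)
    {y : EuclideanSpace ℝ (Fin q)} {a b : M} (ha : a ∈ plaque φ y) (hb : b ∈ plaque φ y) :
    A.Joined a b := by
  refine (F.isPreconnected_plaque hφ y).induction₂' A.Joined (fun c hc => ?_)
    (fun _ _ _ _ _ _ => Joined.trans A) ha hb
  obtain ⟨l, hl⟩ := A.cover c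
  obtain ⟨U, hU, h⟩ := F.compatible φ hφ _ (A.mem_charts l) c ⟨hc.1, hl⟩
  filter_upwards [mem_nhdsWithin_of_mem_nhds hU, self_mem_nhdsWithin,
    mem_nhdsWithin_of_mem_nhds ((A.chart l).open_source.mem_nhds hl)] with d hdU hd hdl
  have hcd : A.proj l c = A.proj l d := h c (mem_of_mem_nhds hU) d hdU (hc.2.trans hd.2.symm)
  exact ⟨A.joined_of_proj_eq hl hdl hcd, A.joined_of_proj_eq hdl hl hcd.symm⟩

/-- The leaf relation, generated by the plaques of all foliated charts, is already generated
by those of the countable atlas. -/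
theorem joined_of_mem_leaf {a b : M} (h : b ∈ F.leaf a) : A.Joined a b := by
  induction h with
  | refl => exact fun i j hi hj => A.proj_mem_orbit_proj hi hj
  | tail _ hbc ih =>
    obtain ⟨φ, hφ, y, hb, hc⟩ := hbc
    exact Joined.trans A ih (A.joined_of_mem_plaque hφ hb hc)

/-- Holonomy maps do not leave the leaf: each plaque in the orbit of a plaque through `a` meets the
leaf of `a`. -/
theorem exists_mem_leaf_of_mem_orbit {i : ℕ} {a : M} (ha : a ∈ (A.chart i).source)
    {t : ℕ × EuclideanSpace ℝ (Fin q)} (ht : t ∈ A.orbit (i, A.proj i a)) :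
    ∃ b ∈ F.leaf a, b ∈ plaque (A.chart t.1) t.2 := by
  obtain ⟨w, rfl⟩ := ht
  induction w with
  | nil => exact ⟨a, F.mem_leaf_self a, ha, rfl⟩
  | cons e w ih =>
    obtain ⟨b, hb, hbp⟩ := ih
    dsimp only at hbp
    have hw : A.word (e :: w) (i, A.proj i a) = A.holonomy e (A.word w (i, A.proj i a)) := rfl
    simp only [hw]
    set t := A.word w (i, A.proj i a)
    by_cases h : A.IsTransition e ∧ t.1 = e.1 ∧ t.2 ∈ A.proj e.1 '' e.2.2
    · obtain ⟨he, h1, c, hc, h2⟩ := h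
      have ht : t = (e.1, A.proj e.1 c) := Prod.ext h1 h2.symm
      rw [ht, he.holonomy_apply hc]
      rw [ht] at hbp
      exact ⟨c, F.mem_leaf_of_mem_plaque hb (A.mem_charts e.1) hbp ⟨he.subset_left hc, rfl⟩,
        he.subset_right hc, rfl⟩
    · rw [A.holonomy_of_not h]
      exact ⟨b, hb, hbp⟩

theorem plaque_subset_leaf_of_mem_orbit {a : M} {t : ℕ × EuclideanSpace ℝ (Fin q)}
    (ht : t ∈ A.orbit (A.toTransversal a)) : plaque (A.chart t.1) t.2 ⊆ F.leaf a := by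
  obtain ⟨b, hb, hbp⟩ := A.exists_mem_leaf_of_mem_orbit (A.mem_source_index a) ht
  exact fun c hc => F.mem_leaf_of_mem_plaque hb (A.mem_charts _) hbp hc

/-- Two points are in one leaf exactly when their plaques are in one holonomy orbit. -/
theorem toTransversal_mem_orbit_iff {a b : M} :
    A.toTransversal b ∈ A.orbit (A.toTransversal a) ↔ b ∈ F.leaf a :=
  ⟨fun h => A.plaque_subset_leaf_of_mem_orbit h ⟨A.mem_source_index b, rfl⟩,
    fun h => A.joined_of_mem_leaf h _ _ (A.mem_source_index a) (A.mem_source_index b)⟩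

/-- Although a holonomy map need not be invertible, orbits are symmetric, because leaves are. -/
theorem toTransversal_mem_orbit_of_mem_orbit {a : M} {t : ℕ × EuclideanSpace ℝ (Fin q)}
    (ht : t ∈ A.orbit (A.toTransversal a)) : A.toTransversal a ∈ A.orbit t := by
  obtain ⟨b, hb, hbp, hbt⟩ := A.exists_mem_leaf_of_mem_orbit (A.mem_source_index a) ht
  have := A.joined_of_mem_leaf (F.mem_leaf_symm hb) _ _ hbp (A.mem_source_index a)
  have h2 : A.proj t.1 b = t.2 := hbt
  rwa [h2] at this

end CountableAtlas

end Foliation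

/-! ### Measurability and null sets under holonomy -/

namespace Foliation

namespace CountableAtlas

variable {k q : ℕ} {M : Type*} [TopologicalSpace M]
  [ChartedSpace (EuclideanSpace ℝ (Fin (k + q))) M] {F : Foliation k q M} (A : F.CountableAtlas)

section Measurable

variable [MeasurableSpace M] [BorelSpace M]

theorem measurableSet_setOf_index_eq (i : ℕ) : MeasurableSet {a | A.index a = i} := by
  rw [setOf_index_eq]
  exact (A.chart i).open_source.measurableSet.diff
    (MeasurableSet.biUnion (to_countable _) fun j _ => (A.chart j).open_source.measurableSet)

theorem measurable_toTransversal : Measurable A.toTransversal := by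
  intro s hs
  have : A.toTransversal ⁻¹' s = ⋃ i, {a | A.index a = i} ∩ ((A.chart i).source ∩
      A.proj i ⁻¹' (Prod.mk i ⁻¹' s)) := by
    ext a
    simp only [mem_preimage, mem_iUnion, mem_inter_iff]
    constructor
    · exact fun h => ⟨_, rfl, A.mem_source_index a, h⟩
    · rintro ⟨i, rfl, -, h⟩
      exact h
  rw [this]
  exact MeasurableSet.iUnion fun i => (A.measurableSet_setOf_index_eq i).inter
    (measurableSet_inter_preimage_of_continuousOn (A.chart i).open_source.measurableSet
      (A.proj_continuousOn i) (measurable_prodMk_left hs))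

theorem measurableSet_fiber (t : ℕ × EuclideanSpace ℝ (Fin q)) :
    MeasurableSet (A.toTransversal ⁻¹' {t}) :=
  A.measurable_toTransversal (measurableSet_singleton t)

end Measurable

variable [SecondCountableTopology M]

/-- Holonomy is smooth: it is a transition map between foliated charts, restricted to a
transversal `{x} × ℝ^q`. -/
theorem IsTransition.differentiableOn {A : F.CountableAtlas} {e : TransitionIndex M}
    (he : A.IsTransition e) :
    DifferentiableOn ℝ (fun y => (A.holonomy e (e.1, y)).2) (A.proj e.1 '' e.2.2) := by
  rintro _ ⟨a, ha, rfl⟩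
  have hU : IsOpen (e.2.2 : Set M) := TopologicalSpace.isOpen_of_mem_countableBasis e.2.2.2
  set φ := A.chart e.1
  set χ := A.chart e.2.1
  have haφ := he.subset_left ha
  -- the transversal through `a` in the chart `φ`
  set ι : EuclideanSpace ℝ (Fin q) → EuclideanSpace ℝ (Fin k) × EuclideanSpace ℝ (Fin q) :=
    fun y => ((φ a).1, y)
  have hopen : IsOpen (φ.target ∩ φ.symm ⁻¹' e.2.2) := φ.isOpen_inter_preimage_symm hU
  have hι : ι (A.proj e.1 a) = φ a := rfl
  have hmem : φ a ∈ φ.target ∩ φ.symm ⁻¹' e.2.2 :=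
    ⟨φ.map_source haφ, by rwa [mem_preimage, φ.left_inv haφ]⟩
  have hsm : ContMDiffOn 𝓘(ℝ, EuclideanSpace ℝ (Fin k) × EuclideanSpace ℝ (Fin q))
      𝓘(ℝ, EuclideanSpace ℝ (Fin k) × EuclideanSpace ℝ (Fin q)) ∞ (χ ∘ φ.symm)
      (φ.target ∩ φ.symm ⁻¹' e.2.2) :=
    (F.smooth χ (A.mem_charts _)).comp
      ((F.smooth_symm φ (A.mem_charts _)).mono inter_subset_left)
      fun u hu => he.subset_right hu.2
  have hd : DifferentiableAt ℝ (χ ∘ φ.symm) (ι (A.proj e.1 a)) :=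
    ((contMDiffOn_iff_contDiffOn.1 hsm).differentiableOn (by simp)).differentiableAt
      (hopen.mem_nhds hmem)
  have hιd : Differentiable ℝ ι := by fun_prop
  have hcomp : DifferentiableAt ℝ (fun y => ((χ ∘ φ.symm) (ι y)).2) (A.proj e.1 a) :=
    differentiableAt_snd.comp _ (hd.comp _ (hιd _))
  refine (hcomp.congr_of_eventuallyEq ?_).differentiableWithinAt
  filter_upwards [hιd.continuous.continuousAt.preimage_mem_nhds (hopen.mem_nhds hmem)] with y hy
  have h1 : A.proj e.1 (φ.symm (ι y)) = y := by
    have : φ (φ.symm (ι y)) = ι y := φ.right_inv hy.1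
    exact congrArg Prod.snd this
  have h2 := he.holonomy_apply hy.2
  rw [h1] at h2
  rw [h2]
  rfl

theorem IsTransition.isOpen_proj_image {A : F.CountableAtlas} {e : TransitionIndex M}
    (he : A.IsTransition e) : IsOpen (A.proj e.1 '' e.2.2) := by
  have hU : IsOpen (e.2.2 : Set M) := TopologicalSpace.isOpen_of_mem_countableBasis e.2.2.2
  have := isOpenMap_snd _ ((A.chart e.1).isOpen_image_of_subset_source hU he.subset_left)
  rwa [image_image] at this

theorem measurable_holonomy (e : TransitionIndex M) : Measurable (A.holonomy e) := by
  refine measurable_from_prod_countable_right fun i => ?_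
  by_cases h : A.IsTransition e ∧ i = e.1
  · obtain ⟨he, rfl⟩ := h
    classical
    have hm := ContinuousOn.measurable_piecewise
      (f := fun y => (A.holonomy e (e.1, y)).2) (g := fun y => y) (s := A.proj e.1 '' e.2.2)
      he.differentiableOn.continuousOn continuousOn_id
      he.isOpen_proj_image.measurableSet
    have hc : Measurable fun y : EuclideanSpace ℝ (Fin q) =>
        if y ∈ A.proj e.1 '' e.2.2 then e.2.1 else e.1 :=
      Measurable.ite he.isOpen_proj_image.measurableSet measurable_const measurable_const
    convert hc.prodMk hm using 1
    ext1 y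
    by_cases hy : y ∈ A.proj e.1 '' e.2.2
    · obtain ⟨a, ha, rfl⟩ := hy
      simp only [piecewise_eq_of_mem _ _ _ (mem_image_of_mem _ ha),
        if_pos (mem_image_of_mem _ ha), he.holonomy_apply ha]
    · simp only [piecewise_eq_of_notMem _ _ _ hy, if_neg hy]
      exact A.holonomy_of_not fun h => hy h.2.2
  · have : ∀ y, A.holonomy e (i, y) = (i, y) := fun y =>
      A.holonomy_of_not fun h' => h ⟨h'.1, h'.2.1⟩
    simp only [this]
    exact measurable_prodMk_left

theorem measurable_word (w : List (TransitionIndex M)) : Measurable (A.word w) := by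
  induction w with
  | nil => exact measurable_id
  | cons e w ih => exact (A.measurable_holonomy e).comp ih

end CountableAtlas

/-- Lebesgue null sets of the total transversal `ℕ × ℝ^q`. -/
def TransversalNull {q : ℕ} (Z : Set (ℕ × EuclideanSpace ℝ (Fin q))) : Prop :=
  ∀ i, volume {y | (i, y) ∈ Z} = 0

namespace CountableAtlas

variable {k q : ℕ} {M : Type*} [TopologicalSpace M]
  [ChartedSpace (EuclideanSpace ℝ (Fin (k + q))) M] {F : Foliation k q M} (A : F.CountableAtlas)

section

variable [SecondCountableTopology M]

theorem transversalNull_image_holonomy (e : TransitionIndex M)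
    {Z : Set (ℕ × EuclideanSpace ℝ (Fin q))} (hZ : TransversalNull Z) :
    TransversalNull (A.holonomy e '' Z) := by
  intro i
  by_cases he : A.IsTransition e
  · have hsub : {y | (i, y) ∈ A.holonomy e '' Z} ⊆ {y | (i, y) ∈ Z} ∪
        (fun y => (A.holonomy e (e.1, y)).2) '' ({y | (e.1, y) ∈ Z} ∩ A.proj e.1 '' e.2.2) := by
      rintro y ⟨⟨j, z⟩, hz, hzy⟩
      by_cases h : A.IsTransition e ∧ j = e.1 ∧ z ∈ A.proj e.1 '' e.2.2
      · obtain ⟨-, rfl, hz'⟩ := h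
        exact Or.inr ⟨z, ⟨hz, hz'⟩, congrArg Prod.snd hzy⟩
      · rw [A.holonomy_of_not h] at hzy
        obtain ⟨rfl, rfl⟩ := Prod.mk.inj hzy
        exact Or.inl hz
    refine measure_mono_null hsub (measure_union_null (hZ i) ?_)
    exact addHaar_image_eq_zero_of_differentiableOn_of_addHaar_eq_zero volume
      (he.differentiableOn.mono inter_subset_right) (measure_mono_null inter_subset_left (hZ e.1))
  · have : ∀ t, A.holonomy e t = t := fun t => A.holonomy_of_not fun h => he h.1
    simp only [this, image_id']
    exact hZ i

theorem transversalNull_image_word (w : List (TransitionIndex M))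
    {Z : Set (ℕ × EuclideanSpace ℝ (Fin q))} (hZ : TransversalNull Z) :
    TransversalNull (A.word w '' Z) := by
  induction w with
  | nil => rwa [show A.word [] '' Z = Z from image_id Z]
  | cons e w ih =>
    have : A.word (e :: w) '' Z = A.holonomy e '' (A.word w '' Z) := by
      rw [image_image]
      rfl
    rw [this]
    exact A.transversalNull_image_holonomy e ih

end

variable [IsManifold (𝓡 (k + q)) ∞ M] [MeasurableSpace M] [BorelSpace M]

/-- The plaques over a null set of the transversal fill a null set of `M`. -/
theorem riemannianVolume_preimage_toTransversal_eq_zero (g : RiemMetric (k + q) M)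
    {Z : Set (ℕ × EuclideanSpace ℝ (Fin q))} (hZ : TransversalNull Z) :
    riemannianVolume g (A.toTransversal ⁻¹' Z) = 0 := by
  let S := fun i => toMeasurable volume {y | (i, y) ∈ Z}
  have hsub : A.toTransversal ⁻¹' Z ⊆ ⋃ i, (A.chart i).source ∩ A.proj i ⁻¹' S i := fun a ha =>
    mem_iUnion.2 ⟨A.index a, A.mem_source_index a, subset_toMeasurable _ _ ha⟩
  refine measure_mono_null hsub (measure_iUnion_null fun i => ?_)
  refine riemannianVolume_eq_zero_of_addHaar_chart_eq_zero (ι := Unit) g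
    ((volume : Measure (EuclideanSpace ℝ (Fin k))).prod
      (volume : Measure (EuclideanSpace ℝ (Fin q)))) (by simp) (fun _ => A.chart i)
    (fun _ => F.smooth_symm _ (A.mem_charts i))
    (measurableSet_inter_preimage_of_continuousOn (A.chart i).open_source.measurableSet
      (A.proj_continuousOn i) (measurableSet_toMeasurable _ _)) (fun a ha => ⟨(), ha.1⟩)
    (fun _ => measure_mono_null (t := univ ×ˢ S i) ?_ ?_)
  · rintro u ⟨hu, -, huS⟩
    rw [mem_preimage, proj, (A.chart i).right_inv hu] at huS
    exact ⟨mem_univ _, huS⟩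
  · rw [Measure.prod_prod, measure_toMeasurable, hZ i, mul_zero]

/-- Almost every plaque slice of a null set is null, by Fubini's theorem. -/
theorem ae_volume_slice_eq_zero [SecondCountableTopology M] (g : RiemMetric (k + q) M) {N : Set M}
    (hN : MeasurableSet N) (h : riemannianVolume g N = 0) (i : ℕ) :
    ∀ᵐ y, volume {x | (x, y) ∈ (A.chart i).target ∩ (A.chart i).symm ⁻¹' N} = 0 := by
  have h1 := addHaar_chart_eq_zero_of_riemannianVolume_eq_zero g
    ((volume : Measure (EuclideanSpace ℝ (Fin k))).prod
      (volume : Measure (EuclideanSpace ℝ (Fin q)))) (by simp) (A.chart i)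
    (F.smooth _ (A.mem_charts i)) hN h
  have hm : MeasurableSet ((A.chart i).target ∩ (A.chart i).symm ⁻¹' N) :=
    measurableSet_inter_preimage_of_continuousOn (A.chart i).open_target.measurableSet
      (A.chart i).symm.continuousOn hN
  rw [← Measure.prod_swap, Measure.map_apply measurable_swap hm] at h1
  exact (Measure.measure_prod_null (measurable_swap hm)).1 h1

end CountableAtlas

end Foliation

/-! ### The volume of a leaf as a sum over plaques -/

section General

/-- Summing over the range of a sequence amounts to summing over the indices at which a value
occurs for the first time. -/
theorem tsum_range_eq_tsum_first {α : Type*} (h : ℕ → α) (G : α → ℝ≥0∞) :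
    ∑' x : range h, G x = ∑' n, {n | ∀ m < n, h m ≠ h n}.indicator (fun n => G (h n)) n := by
  classical
  rw [← tsum_subtype {n | ∀ m < n, h m ≠ h n} (fun n => G (h n))]
  let e : {n | ∀ m < n, h m ≠ h n} ≃ range h := Equiv.ofBijective (fun n => ⟨h n, n, rfl⟩) <| by
    constructor
    · rintro ⟨m, hm⟩ ⟨n, hn⟩ hmn
      have hmn : h m = h n := congrArg Subtype.val hmn
      rcases lt_trichotomy m n with hlt | rfl | hlt
      · exact absurd hmn (hn m hlt)
      · rfl
      · exact absurd hmn.symm (hm n hlt)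
    · rintro ⟨_, n, rfl⟩
      have hex : ∃ m, h m = h n := ⟨n, rfl⟩
      refine ⟨⟨Nat.find hex, fun m hm => ?_⟩, Subtype.ext (Nat.find_spec hex)⟩
      rw [Nat.find_spec hex]
      exact Nat.find_min hex hm
  exact (e.tsum_eq fun x : range h => G x).symm

/-- The sum of a measurable function over the orbit of a point under countably many measurable maps
is a measurable function of the point. -/
theorem measurable_tsum_range {α β : Type*} [MeasurableSpace α] [MeasurableSpace β]
    [MeasurableEq β] {h : ℕ → α → β} (hh : ∀ n, Measurable (h n)) {G : β → ℝ≥0∞}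
    (hG : Measurable G) : Measurable fun a => ∑' x : range (fun n => h n a), G x := by
  simp only [tsum_range_eq_tsum_first]
  refine Measurable.tsum fun n => ?_
  have hm : MeasurableSet {a | ∀ m < n, h m a ≠ h n a} := by
    have : {a | ∀ m < n, h m a ≠ h n a} = ⋂ m ∈ Iio n, {a | h m a = h n a}ᶜ := by
      ext a
      simp
    rw [this]
    exact MeasurableSet.biInter (to_countable _) fun m _ =>
      (measurableSet_eq_fun (hh m) (hh n)).compl
  exact (hG.comp (hh n)).indicator hm

/-- A function that is continuous on a measurable set, composed with a measurable one and extended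
by zero, is measurable. -/
theorem measurable_indicator_of_continuousOn {α : Type*} [TopologicalSpace α]
    [MeasurableSpace α] [OpensMeasurableSpace α] {β : Type*} [TopologicalSpace β]
    [MeasurableSpace β] [BorelSpace β] {f : α → β} {V : Set α} (hV : MeasurableSet V)
    (hf : ContinuousOn f V) {H : β → ℝ≥0∞} (hH : Measurable H) :
    Measurable (V.indicator fun x => H (f x)) := by
  refine measurable_of_restrict_of_restrict_compl hV ?_ ?_
  · have h1 : Measurable (V.domRestrict f) :=
      (continuousOn_iff_continuous_domRestrict.1 hf).measurable
    convert hH.comp h1 using 1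
    ext x
    simp
  · convert measurable_const (a := (0 : ℝ≥0∞)) using 1
    ext x
    exact indicator_of_notMem x.2 _

end General

section ChangeOfParameters

variable {n : ℕ} {M : Type*} [TopologicalSpace M] [ChartedSpace (EuclideanSpace ℝ (Fin n)) M]
  [IsManifold (𝓡 n) ∞ M] [MeasurableSpace M] [BorelSpace M]

/-- Comparison of the volumes of two parametrizations, by the change of variables formula. -/
theorem parametrizedVolume_apply_le (g : RiemMetric n M) {m : ℕ}
    {ψ χ : EuclideanSpace ℝ (Fin m) → M} {V W : Set (EuclideanSpace ℝ (Fin m))}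
    (hV : IsOpen V) (hψ : ContMDiffOn (𝓡 m) (𝓡 n) ∞ ψ V) (hinj : InjOn ψ V)
    (hW : IsOpen W) (hχ : ContMDiffOn (𝓡 m) (𝓡 n) ∞ χ W) {s : Set M} (hs : MeasurableSet s)
    {σ : EuclideanSpace ℝ (Fin m) → EuclideanSpace ℝ (Fin m)}
    (hσ : ∀ x ∈ V ∩ ψ ⁻¹' s, DifferentiableAt ℝ σ x ∧ σ x ∈ W ∧ ψ =ᶠ[𝓝 x] χ ∘ σ) :
    parametrizedVolume g ψ V s ≤ parametrizedVolume g χ W s := by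
  have hm := measurableSet_inter_preimage_of_continuousOn hV.measurableSet hψ.continuousOn hs
  have heq : ∀ x ∈ V ∩ ψ ⁻¹' s, ψ x = χ (σ x) := fun x hx => (hσ x hx).2.2.eq_of_nhds
  rw [parametrizedVolume_apply g hV hψ hs, parametrizedVolume_apply g hW hχ hs]
  calc ∫⁻ x in V ∩ ψ ⁻¹' s, volumeDensity g ψ x
      = ∫⁻ x in V ∩ ψ ⁻¹' s,
          ENNReal.ofReal |(fderiv ℝ σ x).det| * volumeDensity g χ (σ x) := by
        refine setLIntegral_congr_fun hm fun x hx => ?_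
        obtain ⟨h1, h2, h3⟩ := hσ x hx
        exact volumeDensity_comp g h3 h1
          ((hχ.contMDiffAt (hW.mem_nhds h2)).mdifferentiableAt (by simp))
    _ = ∫⁻ x in σ '' (V ∩ ψ ⁻¹' s), volumeDensity g χ x := by
        refine (lintegral_image_eq_lintegral_abs_det_fderiv_mul volume hm
          (fun x hx => (hσ x hx).1.hasFDerivAt.hasFDerivWithinAt) (fun x hx y hy hxy => ?_) _).symm
        exact hinj hx.1 hy.1 (by rw [heq x hx, heq y hy, hxy])
    _ ≤ ∫⁻ x in W ∩ χ ⁻¹' s, volumeDensity g χ x := by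
        refine lintegral_mono_set ?_
        rintro _ ⟨x, hx, rfl⟩
        refine ⟨(hσ x hx).2.1, ?_⟩
        rw [mem_preimage, ← heq x hx]
        exact hx.2

end ChangeOfParameters

namespace Foliation

section Slice

variable {k q : ℕ} {M : Type*} [TopologicalSpace M]
  {φ : OpenPartialHomeomorph M (EuclideanSpace ℝ (Fin k) × EuclideanSpace ℝ (Fin q))}

theorem isOpen_slice
    (φ : OpenPartialHomeomorph M (EuclideanSpace ℝ (Fin k) × EuclideanSpace ℝ (Fin q)))
    (y : EuclideanSpace ℝ (Fin q)) : IsOpen {x | (x, y) ∈ φ.target} :=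
  φ.open_target.preimage (by fun_prop : Continuous fun x => (x, y))

theorem symm_mem_plaque {x : EuclideanSpace ℝ (Fin k)} {y : EuclideanSpace ℝ (Fin q)}
    (h : (x, y) ∈ φ.target) : φ.symm (x, y) ∈ plaque φ y :=
  ⟨φ.map_target h, by rw [φ.right_inv h]⟩

end Slice

variable {k q : ℕ} {M : Type*} [TopologicalSpace M]
  [ChartedSpace (EuclideanSpace ℝ (Fin (k + q))) M]

/-- The inclusion of a plaque is smooth. -/
theorem contMDiffOn_slice
    {φ : OpenPartialHomeomorph M (EuclideanSpace ℝ (Fin k) × EuclideanSpace ℝ (Fin q))}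
    {F : Foliation k q M} (hφ : φ ∈ F.charts)
    (y : EuclideanSpace ℝ (Fin q)) :
    ContMDiffOn (𝓡 k) (𝓡 (k + q)) ∞ (fun x => φ.symm (x, y)) {x | (x, y) ∈ φ.target} := by
  have h : ContMDiff (𝓡 k) 𝓘(ℝ, EuclideanSpace ℝ (Fin k) × EuclideanSpace ℝ (Fin q)) ∞
      fun x : EuclideanSpace ℝ (Fin k) => (x, y) :=
    contMDiff_iff_contDiff.2 (contDiff_id.prodMk contDiff_const)
  exact (F.smooth_symm φ hφ).comp h.contMDiffOn fun x hx => hx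

variable [IsManifold (𝓡 (k + q)) ∞ M] [MeasurableSpace M]

/-- The Riemannian volume of the plaque `{y = const}` of a foliated chart, as a measure on `M`. -/
def plaqueVolume (g : RiemMetric (k + q) M)
    (φ : OpenPartialHomeomorph M (EuclideanSpace ℝ (Fin k) × EuclideanSpace ℝ (Fin q)))
    (y : EuclideanSpace ℝ (Fin q)) : Measure M :=
  parametrizedVolume g (fun x => φ.symm (x, y)) {x | (x, y) ∈ φ.target}

theorem plaqueVolume_le_leafMeasure {F : Foliation k q M} (g : RiemMetric (k + q) M)
    {φ : OpenPartialHomeomorph M (EuclideanSpace ℝ (Fin k) × EuclideanSpace ℝ (Fin q))}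
    (hφ : φ ∈ F.charts) {y : EuclideanSpace ℝ (Fin q)} {L : Set M} (h : plaque φ y ⊆ L) :
    plaqueVolume g φ y ≤ F.leafMeasure g L :=
  le_iSup₂_of_le φ hφ (le_iSup₂_of_le y h le_rfl)

variable [BorelSpace M]

theorem plaqueVolume_eq_zero_of_disjoint {F : Foliation k q M} (g : RiemMetric (k + q) M)
    {φ : OpenPartialHomeomorph M (EuclideanSpace ℝ (Fin k) × EuclideanSpace ℝ (Fin q))}
    (hφ : φ ∈ F.charts) {y : EuclideanSpace ℝ (Fin q)} {s : Set M} (hs : MeasurableSet s)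
    (h : Disjoint (plaque φ y) s) : plaqueVolume g φ y s = 0 := by
  refine parametrizedVolume_apply_eq_zero g (isOpen_slice φ y) (contMDiffOn_slice hφ y) hs ?_
  have : {x | (x, y) ∈ φ.target} ∩ (fun x => φ.symm (x, y)) ⁻¹' s = ∅ :=
    eq_empty_of_forall_notMem fun x hx => disjoint_left.1 h (symm_mem_plaque hx.1) hx.2
  rw [this, measure_empty]

namespace CountableAtlas

variable {F : Foliation k q M} (A : F.CountableAtlas)

/-- The part of the volume of a plaque of the atlas that is carried by the points for which the
chart of that plaque is the first one around them. These parts do not overlap. -/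
def sliceMeasure (g : RiemMetric (k + q) M) (t : ℕ × EuclideanSpace ℝ (Fin q)) : Measure M :=
  (plaqueVolume g (A.chart t.1) t.2).restrict {a | A.index a = t.1}

/-- The slice of index `t` is carried by the fibre of `toTransversal` over `t`; different fibres are
disjoint. -/
theorem sliceMeasure_compl_fiber (g : RiemMetric (k + q) M)
    (t : ℕ × EuclideanSpace ℝ (Fin q)) : A.sliceMeasure g t (A.toTransversal ⁻¹' {t})ᶜ = 0 := by
  have hm := (A.measurableSet_fiber t).compl
  rw [sliceMeasure, Measure.restrict_apply hm]
  refine plaqueVolume_eq_zero_of_disjoint g (A.mem_charts _)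
    (hm.inter (A.measurableSet_setOf_index_eq _)) (disjoint_left.2 fun a ha h => h.1 ?_)
  obtain ⟨h1, h2⟩ := h
  have h2 : A.index a = t.1 := h2
  have ha2 : A.proj t.1 a = t.2 := ha.2
  exact Prod.ext h2 (by rw [toTransversal, h2, ha2])

theorem sliceMeasure_apply (g : RiemMetric (k + q) M) (t : ℕ × EuclideanSpace ℝ (Fin q))
    {s : Set M} : A.sliceMeasure g t s = A.sliceMeasure g t (s ∩ A.toTransversal ⁻¹' {t}) :=
  (measure_inter_conull (A.sliceMeasure_compl_fiber g t)).symm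

/-- A plaque of an arbitrary foliated chart is, near its intersection with a plaque of the atlas,
a reparametrization of the latter. -/
theorem plaqueVolume_apply_le_sliceMeasure (g : RiemMetric (k + q) M)
    {φ : OpenPartialHomeomorph M (EuclideanSpace ℝ (Fin k) × EuclideanSpace ℝ (Fin q))}
    (hφ : φ ∈ F.charts) (y : EuclideanSpace ℝ (Fin q)) (t : ℕ × EuclideanSpace ℝ (Fin q))
    {s : Set M} (hs : MeasurableSet s) :
    plaqueVolume g φ y (s ∩ A.toTransversal ⁻¹' {t}) ≤ A.sliceMeasure g t s := by
  have hm := hs.inter (A.measurableSet_fiber t)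
  set χ := A.chart t.1
  have hχ : χ ∈ F.charts := A.mem_charts t.1
  have hidx : ∀ a ∈ A.toTransversal ⁻¹' {t}, A.index a = t.1 := fun a ha => congrArg Prod.fst ha
  have hsub : s ∩ A.toTransversal ⁻¹' {t} ⊆ s ∩ {a | A.index a = t.1} := fun a ha =>
    ⟨ha.1, hidx a ha.2⟩
  rw [sliceMeasure, Measure.restrict_apply hs]
  refine le_trans ?_ (measure_mono hsub)
  refine parametrizedVolume_apply_le g (isOpen_slice φ y) (contMDiffOn_slice hφ y) ?_
    (isOpen_slice χ t.2) (contMDiffOn_slice hχ t.2) hm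
    (σ := fun x => (χ (φ.symm (x, y))).1) ?_
  · intro x hx x' hx' h
    exact congrArg Prod.fst (φ.symm.injOn hx hx' h)
  · rintro x ⟨hx, -, hxt⟩
    set a := φ.symm (x, y) with ha
    have haχ : a ∈ χ.source := by
      have := A.mem_source_index a
      rwa [hidx a hxt] at this
    have hat : (χ a).2 = t.2 := by
      have h1 : A.toTransversal a = t := hxt
      have h2 : A.proj (A.index a) a = t.2 := congrArg Prod.snd h1
      rwa [hidx a hxt] at h2
    have haφ : a ∈ plaque φ y := symm_mem_plaque hx
    have hψ := contMDiffOn_slice hφ y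
    have hψa := hψ.contMDiffAt ((isOpen_slice φ y).mem_nhds hx)
    refine ⟨?_, ?_, ?_⟩
    · have h1 : ContMDiffAt (𝓡 (k + q))
          𝓘(ℝ, EuclideanSpace ℝ (Fin k) × EuclideanSpace ℝ (Fin q)) ∞ χ (φ.symm (x, y)) :=
        (F.smooth χ hχ).contMDiffAt (χ.open_source.mem_nhds haχ)
      have h2 := h1.comp x hψa
      have h3 : DifferentiableAt ℝ (fun x => χ (φ.symm (x, y))) x :=
        (contMDiffAt_iff_contDiffAt.1 h2).differentiableAt (by simp)
      exact h3.fst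
    · have : ((χ a).1, t.2) = χ a := by rw [← hat]
      rw [mem_ofPred_eq, this]
      exact χ.map_source haχ
    · obtain ⟨U, hU, h⟩ := F.compatible φ hφ χ hχ a ⟨haφ.1, haχ⟩
      filter_upwards [(isOpen_slice φ y).mem_nhds hx, hψa.continuousAt.preimage_mem_nhds
        (Filter.inter_mem hU (χ.open_source.mem_nhds haχ))] with z hz hzU
      have h1 : (χ a).2 = (χ (φ.symm (z, y))).2 :=
        h a (mem_of_mem_nhds hU) _ hzU.1 (haφ.2.trans (symm_mem_plaque hz).2.symm)
      have h2 : ((χ (φ.symm (z, y))).1, t.2) = χ (φ.symm (z, y)) := by rw [← hat, h1]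
      rw [Function.comp_apply, h2, χ.left_inv hzU.2]

theorem lintegral_sliceMeasure (g : RiemMetric (k + q) M) (t : ℕ × EuclideanSpace ℝ (Fin q))
    {H : M → ℝ≥0∞} (hH : Measurable H) :
    ∫⁻ b, H b ∂(A.sliceMeasure g t) = ∫⁻ x, (A.chart t.1).target.indicator
      (fun u => volumeDensity g (fun x => (A.chart t.1).symm (x, u.2)) u.1 *
        {a | A.index a = t.1}.indicator H ((A.chart t.1).symm u)) (x, t.2) := by
  rw [sliceMeasure, ← lintegral_indicator (A.measurableSet_setOf_index_eq _), plaqueVolume,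
    lintegral_parametrizedVolume g (isOpen_slice _ _) (contMDiffOn_slice (A.mem_charts _) _)
      (hH.indicator (A.measurableSet_setOf_index_eq _)),
    ← lintegral_indicator (isOpen_slice _ _).measurableSet]
  rfl

/-- The integral over a slice depends measurably on the slice, by Tonelli's theorem. -/
theorem measurable_lintegral_sliceMeasure (g : RiemMetric (k + q) M) {H : M → ℝ≥0∞}
    (hH : Measurable H) : Measurable fun t => ∫⁻ b, H b ∂(A.sliceMeasure g t) := by
  refine measurable_from_prod_countable_right fun i => ?_
  simp only [A.lintegral_sliceMeasure g _ hH]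
  refine Measurable.lintegral_prod_left' (f := fun u : EuclideanSpace ℝ (Fin k) ×
    EuclideanSpace ℝ (Fin q) => (A.chart i).target.indicator
      (fun u => volumeDensity g (fun x => (A.chart i).symm (x, u.2)) u.1 *
        {a | A.index a = i}.indicator H ((A.chart i).symm u)) u) ?_
  have hV := (A.chart i).open_target
  have h1 := measurable_indicator_of_continuousOn hV.measurableSet
    (volumeDensity_slice_continuousOn g hV (F.smooth_symm _ (A.mem_charts i))) measurable_id
  have h2 := measurable_indicator_of_continuousOn hV.measurableSet (A.chart i).symm.continuousOn
    (hH.indicator (A.measurableSet_setOf_index_eq i))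
  convert h1.mul h2 using 1
  ext u
  by_cases hu : u ∈ (A.chart i).target <;> simp [hu]

variable [SecondCountableTopology M]

/-- The volume of a leaf is the sum of the volumes of the non-overlapping parts of its plaques in
a countable atlas. -/
theorem leafMeasure_leaf (g : RiemMetric (k + q) M) (a : M) :
    F.leafMeasure g (F.leaf a) =
      Measure.sum fun t : A.orbit (A.toTransversal a) => A.sliceMeasure g t := by
  have := (A.countable_orbit (A.toTransversal a)).to_subtype
  refine le_antisymm ?_ ?_
  · refine iSup₂_le fun φ hφ => iSup₂_le fun y hy => Measure.le_iff.2 fun s hs => ?_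
    change plaqueVolume g φ y s ≤ _
    -- the leaf is covered by the fibres over its orbit, so nothing is lost outside of them
    have hcompl : plaqueVolume g φ y (⋃ t : A.orbit (A.toTransversal a),
        A.toTransversal ⁻¹' {t.1})ᶜ = 0 := by
      refine plaqueVolume_eq_zero_of_disjoint g hφ
        (MeasurableSet.iUnion fun t => A.measurableSet_fiber _).compl
        (disjoint_left.2 fun b hb h => h ?_)
      exact mem_iUnion.2 ⟨⟨_, A.toTransversal_mem_orbit_iff.2 (hy hb)⟩, rfl⟩
    rw [← measure_inter_conull hcompl, inter_iUnion, Measure.sum_apply _ hs]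
    exact (measure_iUnion_le _).trans (ENNReal.tsum_le_tsum fun t =>
      A.plaqueVolume_apply_le_sliceMeasure g hφ y t hs)
  · refine Measure.le_iff.2 fun s hs => ?_
    rw [Measure.sum_apply _ hs]
    calc ∑' t : A.orbit (A.toTransversal a), A.sliceMeasure g t s
        ≤ ∑' t : A.orbit (A.toTransversal a),
            F.leafMeasure g (F.leaf a) (s ∩ A.toTransversal ⁻¹' {t.1}) := by
          refine ENNReal.tsum_le_tsum fun t => ?_
          rw [A.sliceMeasure_apply]
          exact (Measure.restrict_apply_le _ _).trans (plaqueVolume_le_leafMeasure g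
            (A.mem_charts _) (A.plaque_subset_leaf_of_mem_orbit t.2) _)
      _ = F.leafMeasure g (F.leaf a) (⋃ t : A.orbit (A.toTransversal a),
            s ∩ A.toTransversal ⁻¹' {t.1}) := by
          refine (measure_iUnion (fun t t' h => disjoint_left.2 fun b hb hb' => h ?_)
            fun t => hs.inter (A.measurableSet_fiber _)).symm
          exact Subtype.ext (hb.2.symm.trans hb'.2)
      _ ≤ _ := measure_mono (iUnion_subset fun t => inter_subset_left)

end CountableAtlas

variable [SecondCountableTopology M]

/-- The volume of a leaf is concentrated on the leaf. -/
theorem leafMeasure_compl_leaf (F : Foliation k q M) (g : RiemMetric (k + q) M) (a : M) :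
    F.leafMeasure g (F.leaf a) (F.leaf a)ᶜ = 0 := by
  have : Nonempty M := ⟨a⟩
  obtain ⟨A⟩ := F.nonempty_countableAtlas
  have := (A.countable_orbit (A.toTransversal a)).to_subtype
  have hsub : (F.leaf a)ᶜ ⊆ (⋃ t : A.orbit (A.toTransversal a), A.toTransversal ⁻¹' {t.1})ᶜ := by
    refine compl_subset_compl.2 (iUnion_subset fun t b hb => ?_)
    refine A.toTransversal_mem_orbit_iff.1 ?_
    have h : A.toTransversal b = t := hb
    exact h ▸ t.2
  refine measure_mono_null hsub ?_
  rw [A.leafMeasure_leaf, Measure.sum_apply_eq_zero]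
  intro t
  exact measure_mono_null (compl_subset_compl.2 (subset_iUnion
    (fun t : A.orbit (A.toTransversal a) => A.toTransversal ⁻¹' {t.1}) t))
    (A.sliceMeasure_compl_fiber g t)

/-- The integral of a Borel function over a leaf is a measurable function of a point of the
leaf. -/
theorem measurable_lintegral_leafMeasure (F : Foliation k q M) (g : RiemMetric (k + q) M)
    {H : M → ℝ≥0∞}
    (hH : Measurable H) : Measurable fun a => ∫⁻ b, H b ∂(F.leafMeasure g (F.leaf a)) := by
  have : Countable (TopologicalSpace.countableBasis M) :=
    (TopologicalSpace.countable_countableBasis M).to_subtype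
  rcases isEmpty_or_nonempty M with hM | hM
  · exact measurable_of_empty _
  obtain ⟨A⟩ := F.nonempty_countableAtlas
  obtain ⟨e, he⟩ := exists_surjective_nat (List (CountableAtlas.TransitionIndex M))
  have hr : ∀ a, A.orbit (A.toTransversal a) = range fun n => A.word (e n) (A.toTransversal a) :=
    fun a => (he.range_comp fun w => A.word w (A.toTransversal a)).symm
  have heq : (fun a => ∫⁻ b, H b ∂(F.leafMeasure g (F.leaf a))) = fun a =>
      ∑' t : range (fun n => A.word (e n) (A.toTransversal a)),
        ∫⁻ b, H b ∂(A.sliceMeasure g t) := by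
    ext a
    rw [A.leafMeasure_leaf, lintegral_sum_measure, hr a]
  rw [heq]
  exact measurable_tsum_range (fun n => (A.measurable_word (e n)).comp A.measurable_toTransversal)
    (A.measurable_lintegral_sliceMeasure g hH)

/-- A Borel null set meets almost every leaf in a set of zero leaf volume: the exceptional plaques
form a null set of the transversal by Fubini's theorem, and so does its holonomy saturation. -/
theorem riemannianVolume_setOf_leafMeasure_ne_zero (F : Foliation k q M)
    (g : RiemMetric (k + q) M) {N : Set M}
    (hN : MeasurableSet N) (h : riemannianVolume g N = 0) :
    riemannianVolume g {a | F.leafMeasure g (F.leaf a) N ≠ 0} = 0 := by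
  have : Countable (TopologicalSpace.countableBasis M) :=
    (TopologicalSpace.countable_countableBasis M).to_subtype
  rcases isEmpty_or_nonempty M with hM | hM
  · rw [eq_empty_of_isEmpty {a | F.leafMeasure g (F.leaf a) N ≠ 0}, measure_empty]
  obtain ⟨A⟩ := F.nonempty_countableAtlas
  let Z : Set (ℕ × EuclideanSpace ℝ (Fin q)) := {t | A.sliceMeasure g t N ≠ 0}
  have hZ : TransversalNull Z := by
    intro i
    refine measure_mono_null (fun y hy => ?_) (ae_iff.1 (A.ae_volume_slice_eq_zero g hN h i))
    refine fun h0 => hy (nonpos_iff_eq_zero.1 ((Measure.restrict_apply_le _ _).trans_eq ?_))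
    exact parametrizedVolume_apply_eq_zero g (isOpen_slice _ _)
      (contMDiffOn_slice (A.mem_charts _) _) hN h0
  have hsub : {a | F.leafMeasure g (F.leaf a) N ≠ 0} ⊆
      ⋃ w, A.toTransversal ⁻¹' (A.word w '' Z) := by
    intro a ha
    rw [mem_ofPred_eq, A.leafMeasure_leaf, ne_eq, Measure.sum_apply_eq_zero' hN, not_forall] at ha
    obtain ⟨t, ht⟩ := ha
    obtain ⟨w, hw⟩ := A.toTransversal_mem_orbit_of_mem_orbit t.2
    exact mem_iUnion.2 ⟨w, t, ht, hw⟩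
  exact measure_mono_null hsub (measure_iUnion_null fun w =>
    A.riemannianVolume_preimage_toTransversal_eq_zero g (A.transversalNull_image_word w hZ))

end Foliation

/-! ### Minimizing sequences in `Lᵖ` -/

section UniformConvexity

/-- A quantitative form of the strict convexity of `x ↦ x ^ r`, which gives the uniform convexity
of the nonnegative cone of `Lʳ`. By homogeneity it suffices to treat the compact set
`a ^ r + b ^ r = 1`. -/
theorem exists_abs_sub_rpow_le {r : ℝ} (hr : 1 < r) {ε : ℝ} (hε : 0 < ε) :
    ∃ C : ℝ, 0 ≤ C ∧ ∀ a b : ℝ, 0 ≤ a → 0 ≤ b →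
      |a - b| ^ r ≤ ε * (a ^ r + b ^ r) + C * ((a ^ r + b ^ r) / 2 - ((a + b) / 2) ^ r) := by
  have hr0 : 0 < r := by linarith
  let D : ℝ × ℝ → ℝ := fun u => (u.1 ^ r + u.2 ^ r) / 2 - ((u.1 + u.2) / 2) ^ r
  have hDc : Continuous D := by
    have h : Continuous fun x : ℝ => x ^ r := Real.continuous_rpow_const hr0.le
    exact (((h.comp continuous_fst).add (h.comp continuous_snd)).div_const 2).sub
      (h.comp ((continuous_fst.add continuous_snd).div_const 2))
  have hDpos : ∀ a b : ℝ, 0 ≤ a → 0 ≤ b → a ≠ b → 0 < D (a, b) := by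
    intro a b ha hb hab
    have := (strictConvexOn_rpow hr).2 (mem_Ici.2 ha) (mem_Ici.2 hb) hab
      (show (0 : ℝ) < 1 / 2 by norm_num) (show (0 : ℝ) < 1 / 2 by norm_num) (by norm_num)
    simp only [smul_eq_mul] at this
    have h2 : 1 / 2 * a + 1 / 2 * b = (a + b) / 2 := by ring
    rw [h2] at this
    simp only [D]
    linarith
  have hDnonneg : ∀ a b : ℝ, 0 ≤ a → 0 ≤ b → 0 ≤ D (a, b) := by
    intro a b ha hb
    by_cases hab : a = b
    · subst hab
      have : (a + a) / 2 = a := by ring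
      simp [D, this]
    · exact (hDpos a b ha hb hab).le
  have hpow : Continuous fun x : ℝ => x ^ r := Real.continuous_rpow_const hr0.le
  let K : Set (ℝ × ℝ) := (Icc 0 1 ×ˢ Icc 0 1) ∩ {u | ε ≤ |u.1 - u.2| ^ r}
  have hK : IsCompact K := (isCompact_Icc.prod isCompact_Icc).inter_right
    (isClosed_le continuous_const (hpow.comp (continuous_fst.sub continuous_snd).abs))
  obtain ⟨δ, hδ, hδK⟩ : ∃ δ > 0, ∀ u ∈ K, δ ≤ D u := by
    rcases K.eq_empty_or_nonempty with h | h
    · exact ⟨1, one_pos, by simp [h]⟩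
    · obtain ⟨u, hu, hmin⟩ := hK.exists_isMinOn h hDc.continuousOn
      refine ⟨D u, hDpos u.1 u.2 hu.1.1.1 hu.1.2.1 fun h => ?_, fun v hv => hmin hv⟩
      have h2 : ε ≤ |u.1 - u.2| ^ r := hu.2
      rw [h, sub_self, abs_zero, Real.zero_rpow hr0.ne'] at h2
      linarith
  have hnorm : ∀ a b : ℝ, 0 ≤ a → 0 ≤ b → a ^ r + b ^ r = 1 →
      |a - b| ^ r ≤ ε + δ⁻¹ * D (a, b) := by
    intro a b ha hb hab
    have h1 : ∀ c d : ℝ, 0 ≤ c → 0 ≤ d → c ^ r + d ^ r = 1 → c ≤ 1 := by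
      intro c d hc hd hcd
      by_contra! hlt
      have := Real.one_lt_rpow hlt hr0
      have := Real.rpow_nonneg hd r
      linarith
    have ha1 := h1 a b ha hb hab
    have hb1 := h1 b a hb ha (by rw [add_comm]; exact hab)
    by_cases hlt : ε ≤ |a - b| ^ r
    · have h2 := hδK (a, b) ⟨⟨⟨ha, ha1⟩, ⟨hb, hb1⟩⟩, hlt⟩
      have h3 : |a - b| ^ r ≤ 1 :=
        Real.rpow_le_one (abs_nonneg _) (abs_le.2 ⟨by linarith, by linarith⟩) hr0.le
      have h4 : 1 ≤ δ⁻¹ * D (a, b) := by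
        rw [inv_mul_eq_div, le_div_iff₀ hδ]
        linarith
      linarith
    · have h2 : 0 ≤ δ⁻¹ * D (a, b) := mul_nonneg (inv_nonneg.2 hδ.le) (hDnonneg a b ha hb)
      linarith [not_le.1 hlt]
  refine ⟨δ⁻¹, inv_nonneg.2 hδ.le, fun a b ha hb => ?_⟩
  have hS : 0 ≤ a ^ r + b ^ r := add_nonneg (Real.rpow_nonneg ha r) (Real.rpow_nonneg hb r)
  rcases hS.eq_or_lt with h0 | hSpos
  · have ha0 : a ^ r = 0 := by
      have := Real.rpow_nonneg ha r
      have := Real.rpow_nonneg hb r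
      linarith
    have hb0 : b ^ r = 0 := by linarith
    rw [Real.rpow_eq_zero ha hr0.ne'] at ha0
    rw [Real.rpow_eq_zero hb hr0.ne'] at hb0
    simp [ha0, hb0, Real.zero_rpow hr0.ne']
  · set s := (a ^ r + b ^ r) ^ (1 / r) with hs
    have hspos : 0 < s := Real.rpow_pos_of_pos hSpos _
    have hsr : s ^ r = a ^ r + b ^ r := by
      rw [hs, ← Real.rpow_mul hS, one_div_mul_cancel hr0.ne', Real.rpow_one]
    have h1 := hnorm (a / s) (b / s) (div_nonneg ha hspos.le) (div_nonneg hb hspos.le) (by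
      rw [Real.div_rpow ha hspos.le, Real.div_rpow hb hspos.le, hsr, ← add_div,
        div_self hSpos.ne'])
    have h2 : |a / s - b / s| = |a - b| / s := by
      rw [← sub_div, abs_div, abs_of_pos hspos]
    have h3 : (a / s + b / s) / 2 = (a + b) / 2 / s := by ring
    simp only [D] at h1
    rw [h2, h3, Real.div_rpow (abs_nonneg _) hspos.le, Real.div_rpow ha hspos.le,
      Real.div_rpow hb hspos.le, Real.div_rpow (by positivity) hspos.le, hsr,
      div_le_iff₀ hSpos] at h1
    refine h1.trans_eq ?_
    field_simp

end UniformConvexity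

section Minimizing

variable {Ω : Type*} [MeasurableSpace Ω] {μ : Measure Ω} {p : ℝ≥0∞}

theorem integral_norm_rpow_eq {f : Ω → ℝ} (hf : MemLp f p μ) (hp0 : p ≠ 0) (hp : p ≠ ⊤) :
    ∫ a, ‖f a‖ ^ p.toReal ∂μ = (eLpNorm f p μ).toReal ^ p.toReal := by
  have hr : 0 < p.toReal := ENNReal.toReal_pos hp0 hp
  have h0 : 0 ≤ ∫ a, ‖f a‖ ^ p.toReal ∂μ :=
    integral_nonneg fun a => Real.rpow_nonneg (norm_nonneg _) _
  rw [hf.eLpNorm_eq_integral_rpow_norm hp0 hp, ENNReal.toReal_ofReal (Real.rpow_nonneg h0 _),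
    ← Real.rpow_mul h0, inv_mul_cancel₀ hr.ne', Real.rpow_one]

/-- Nonnegative functions whose norms are close to `R` are close to each other if the norm of their
midpoint is at least `R`. -/
theorem exists_eLpNorm_sub_lt (hp1 : 1 < p) (hp : p ≠ ⊤) {R B : ℝ} (hR : 0 ≤ R) (hB : 0 < B) :
    ∃ η > 0, ∀ f g : Ω → ℝ, MemLp f p μ → MemLp g p μ → (∀ a, 0 ≤ f a) → (∀ a, 0 ≤ g a) →
      (eLpNorm f p μ).toReal ≤ R + η → (eLpNorm g p μ).toReal ≤ R + η →
      R ≤ (eLpNorm (fun a => (f a + g a) / 2) p μ).toReal →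
      (eLpNorm (fun a => f a - g a) p μ).toReal < B := by
  have hp0 : p ≠ 0 := (zero_lt_one.trans hp1).ne'
  set r := p.toReal with hr_def
  have hr : 1 < r := by
    rw [hr_def, ← ENNReal.toReal_one]
    exact (ENNReal.toReal_lt_toReal ENNReal.one_ne_top hp).2 hp1
  have hr0 : 0 < r := by linarith
  have hβ : 0 < B ^ r := Real.rpow_pos_of_pos hB r
  have hR1 : 0 < (R + 1) ^ r := Real.rpow_pos_of_pos (by linarith) r
  -- `ε` makes the first term of the convexity inequality at most `B ^ r / 4`
  obtain ⟨C, hC0, hC⟩ := exists_abs_sub_rpow_le hr (ε := B ^ r / (8 * (R + 1) ^ r)) (by positivity)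
  have hcont : Filter.Tendsto (fun η : ℝ => C * ((R + η) ^ r - R ^ r)) (𝓝[>] 0) (𝓝 0) := by
    have h1 : Continuous fun η : ℝ => C * ((R + η) ^ r - R ^ r) :=
      continuous_const.mul (((Real.continuous_rpow_const hr0.le).comp
        (continuous_const.add continuous_id)).sub continuous_const)
    have h2 := h1.tendsto 0
    simp only [add_zero, sub_self, mul_zero] at h2
    exact h2.mono_left nhdsWithin_le_nhds
  obtain ⟨η, hη, hη1, hη0⟩ := ((hcont.eventually_lt_const (half_pos hβ)).and
    ((Ioo_mem_nhdsGT one_pos : Ioo (0 : ℝ) 1 ∈ 𝓝[>] 0))).exists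
  have hη1' : 0 < η := hη1
  refine ⟨η, hη1, fun f g hf hg hf0 hg0 hfR hgR hmid => ?_⟩
  have hm : MemLp (fun a => (f a + g a) / 2) p μ := by
    have := (hf.add hg).const_mul (1 / 2 : ℝ)
    convert this using 1
    ext a
    simp only [Pi.add_apply]
    ring
  have hs : MemLp (fun a => f a - g a) p μ := hf.sub hg
  have hJ : ∀ {h : Ω → ℝ}, MemLp h p μ → Integrable (fun a => ‖h a‖ ^ r) μ :=
    fun hh => hh.integrable_norm_rpow hp0 hp
  have hint : ∫ a, ‖f a - g a‖ ^ r ∂μ ≤ ∫ a, (B ^ r / (8 * (R + 1) ^ r) *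
      (‖f a‖ ^ r + ‖g a‖ ^ r) + C * ((‖f a‖ ^ r + ‖g a‖ ^ r) / 2 - ‖(f a + g a) / 2‖ ^ r)) ∂μ := by
    refine integral_mono (hJ hs) (((hJ hf).add (hJ hg)).const_mul _ |>.add
      (((((hJ hf).add (hJ hg)).div_const 2).sub (hJ hm)).const_mul C)) fun a => ?_
    have := hC (f a) (g a) (hf0 a) (hg0 a)
    have h2 : 0 ≤ (f a + g a) / 2 := by linarith [hf0 a, hg0 a]
    simpa only [Real.norm_eq_abs, abs_of_nonneg (hf0 a), abs_of_nonneg (hg0 a),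
      abs_of_nonneg h2] using this
  have hval : ∫ a, (B ^ r / (8 * (R + 1) ^ r) * (‖f a‖ ^ r + ‖g a‖ ^ r) +
      C * ((‖f a‖ ^ r + ‖g a‖ ^ r) / 2 - ‖(f a + g a) / 2‖ ^ r)) ∂μ =
      B ^ r / (8 * (R + 1) ^ r) * (∫ a, ‖f a‖ ^ r ∂μ + ∫ a, ‖g a‖ ^ r ∂μ) +
      C * ((∫ a, ‖f a‖ ^ r ∂μ + ∫ a, ‖g a‖ ^ r ∂μ) / 2 - ∫ a, ‖(f a + g a) / 2‖ ^ r ∂μ) := by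
    have hfg := (hJ hf).add (hJ hg)
    rw [integral_add (f := fun a => B ^ r / (8 * (R + 1) ^ r) * (‖f a‖ ^ r + ‖g a‖ ^ r))
      (g := fun a => C * ((‖f a‖ ^ r + ‖g a‖ ^ r) / 2 - ‖(f a + g a) / 2‖ ^ r))
      (hfg.const_mul _) (((hfg.div_const 2).sub (hJ hm)).const_mul C),
      integral_const_mul, integral_const_mul,
      integral_sub (f := fun a => (‖f a‖ ^ r + ‖g a‖ ^ r) / 2)
        (hfg.div_const 2) (hJ hm), integral_div, integral_add (hJ hf) (hJ hg)]
  rw [hval, integral_norm_rpow_eq hs hp0 hp, integral_norm_rpow_eq hf hp0 hp,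
    integral_norm_rpow_eq hg hp0 hp, integral_norm_rpow_eq hm hp0 hp] at hint
  have hf' := Real.rpow_le_rpow ENNReal.toReal_nonneg hfR hr0.le
  have hg' := Real.rpow_le_rpow ENNReal.toReal_nonneg hgR hr0.le
  have hm' := Real.rpow_le_rpow hR hmid hr0.le
  have hη' : (R + η) ^ r ≤ (R + 1) ^ r :=
    Real.rpow_le_rpow (by linarith) (by linarith) hr0.le
  have hlt : (eLpNorm (fun a => f a - g a) p μ).toReal ^ r < B ^ r := by
    refine hint.trans_lt ?_
    rw [← hr_def]
    set x := (eLpNorm f p μ).toReal ^ r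
    set y := (eLpNorm g p μ).toReal ^ r
    set z := (eLpNorm (fun a => (f a + g a) / 2) p μ).toReal ^ r
    have h1 : B ^ r / (8 * (R + 1) ^ r) * (x + y) ≤ B ^ r / (8 * (R + 1) ^ r) *
        (2 * (R + 1) ^ r) := mul_le_mul_of_nonneg_left (by linarith) (by positivity)
    have h2 : B ^ r / (8 * (R + 1) ^ r) * (2 * (R + 1) ^ r) = B ^ r / 4 := by
      field_simp
      norm_num
    have h3 : C * ((x + y) / 2 - z) ≤ C * ((R + η) ^ r - R ^ r) :=
      mul_le_mul_of_nonneg_left (by linarith) hC0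
    linarith
  exact (Real.rpow_lt_rpow_iff ENNReal.toReal_nonneg hB.le hr0).1 hlt

/-- A minimizing sequence of a midpoint-convex family of nonnegative functions converges in `Lᵖ`. -/
theorem exists_tendsto_of_midpoint_mem (hp1 : 1 < p) (hp : p ≠ ⊤) {𝒞 : Set (Ω → ℝ)}
    (hne : 𝒞.Nonempty) (hLp : ∀ f ∈ 𝒞, MemLp f p μ) (hnn : ∀ f ∈ 𝒞, ∀ a, 0 ≤ f a)
    (hmid : ∀ f ∈ 𝒞, ∀ g ∈ 𝒞, (fun a => (f a + g a) / 2) ∈ 𝒞) :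
    ∃ (f : ℕ → Ω → ℝ) (f₀ : Ω → ℝ), (∀ n, f n ∈ 𝒞) ∧ Measurable f₀ ∧ (∀ a, 0 ≤ f₀ a) ∧
      MemLp f₀ p μ ∧
      Filter.Tendsto (fun n => eLpNorm (fun a => f n a - f₀ a) p μ) Filter.atTop (𝓝 0) ∧
      eLpNorm f₀ p μ ≤ ⨅ f ∈ 𝒞, eLpNorm f p μ := by
  set I := ⨅ f ∈ 𝒞, eLpNorm f p μ with hI
  have hIle : ∀ f ∈ 𝒞, I ≤ eLpNorm f p μ := fun f hf => iInf₂_le f hf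
  have hItop : I ≠ ⊤ := by
    obtain ⟨f, hf⟩ := hne
    exact ((hIle f hf).trans_lt (hLp f hf).2).ne
  choose η hη0 hη using fun N : ℕ => exists_eLpNorm_sub_lt (μ := μ) hp1 hp
    (ENNReal.toReal_nonneg (a := I)) (show (0 : ℝ) < (1 / 2) ^ N by positivity)
  -- a common choice of tolerances that decreases to zero
  let δ : ℕ → ℝ := fun n => (Finset.range (n + 1)).inf' ⟨0, by simp⟩
    fun i => min (η i) (1 / ((i : ℝ) + 1))
  have hδ0 : ∀ n, 0 < δ n := fun n =>
    (Finset.lt_inf'_iff _).2 fun i _ => lt_min (hη0 i) (by positivity)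
  have hδle : ∀ N n, N ≤ n → δ n ≤ min (η N) (1 / ((N : ℝ) + 1)) := fun N n h =>
    Finset.inf'_le _ (Finset.mem_range.2 (by omega))
  have hex : ∀ n, ∃ f ∈ 𝒞, eLpNorm f p μ < I + ENNReal.ofReal (δ n) := by
    intro n
    have hlt : I < I + ENNReal.ofReal (δ n) :=
      ENNReal.lt_add_right hItop (ENNReal.ofReal_pos.2 (hδ0 n)).ne'
    conv_lhs at hlt => rw [hI]
    simpa only [iInf_lt_iff, exists_prop] using hlt
  choose f hf𝒞 hfI using hex
  have hfR : ∀ N n, N ≤ n → (eLpNorm (f n) p μ).toReal ≤ I.toReal + η N := by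
    intro N n h
    have h1 := ENNReal.toReal_mono (ENNReal.add_ne_top.2 ⟨hItop, ENNReal.ofReal_ne_top⟩) (hfI n).le
    rw [ENNReal.toReal_add hItop ENNReal.ofReal_ne_top, ENNReal.toReal_ofReal (hδ0 n).le] at h1
    linarith [(hδle N n h).trans (min_le_left _ _)]
  have hcau : ∀ N n m : ℕ, N ≤ n → N ≤ m →
      eLpNorm (f n - f m) p μ < ENNReal.ofReal ((1 / 2) ^ N) := by
    intro N n m hn hm
    have hmem : MemLp (f n - f m) p μ := (hLp _ (hf𝒞 n)).sub (hLp _ (hf𝒞 m))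
    rw [ENNReal.lt_ofReal_iff_toReal_lt hmem.2.ne]
    refine hη N (f n) (f m) (hLp _ (hf𝒞 n)) (hLp _ (hf𝒞 m)) (hnn _ (hf𝒞 n)) (hnn _ (hf𝒞 m))
      (hfR N n hn) (hfR N m hm) ?_
    have := hmid _ (hf𝒞 n) _ (hf𝒞 m)
    exact ENNReal.toReal_mono (hLp _ this).2.ne (hIle _ this)
  have hsum : ∑' N : ℕ, ENNReal.ofReal ((1 / 2 : ℝ) ^ N) ≠ ⊤ := by
    rw [← ENNReal.ofReal_tsum_of_nonneg (fun n => by positivity) summable_geometric_two]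
    exact ENNReal.ofReal_ne_top
  obtain ⟨h, hh, hlim⟩ := Lp.cauchy_complete_eLpNorm hp1.le (fun n => hLp _ (hf𝒞 n)) hsum hcau
  -- a Borel representative of the limit, made nonnegative everywhere
  let f₀ : Ω → ℝ := fun a => max (hh.1.mk h a) 0
  have hlim₀ : Filter.Tendsto (fun n => eLpNorm (fun a => f n a - f₀ a) p μ) Filter.atTop
      (𝓝 0) := by
    refine tendsto_of_tendsto_of_tendsto_of_le_of_le tendsto_const_nhds hlim
      (fun n => zero_le) fun n => eLpNorm_mono_ae ?_
    filter_upwards [hh.1.ae_eq_mk] with a ha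
    have := abs_max_sub_max_le_abs (f n a) (hh.1.mk h a) 0
    rw [max_eq_left (hnn _ (hf𝒞 n) a)] at this
    simpa only [Real.norm_eq_abs, Pi.sub_apply, ha] using this
  have hm₀ : Measurable f₀ := hh.1.stronglyMeasurable_mk.measurable.max measurable_const
  have hnn₀ : ∀ a, 0 ≤ f₀ a := fun a => le_max_right _ _
  have hLp₀ : MemLp f₀ p μ := by
    refine (hh.ae_eq hh.1.ae_eq_mk).of_le hm₀.aestronglyMeasurable (ae_of_all _ fun a => ?_)
    simp only [Real.norm_eq_abs, f₀]
    exact abs_max_le_max_abs_abs.trans (by simp)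
  refine ⟨f, f₀, hf𝒞, hm₀, hnn₀, hLp₀, hlim₀, ?_⟩
  have hbound : ∀ n : ℕ, eLpNorm f₀ p μ ≤ I + ENNReal.ofReal (1 / ((n : ℝ) + 1)) +
      eLpNorm (fun a => f n a - f₀ a) p μ := by
    intro n
    have h1 : f₀ = f n - fun a => f n a - f₀ a := by
      ext a
      simp
    calc eLpNorm f₀ p μ = eLpNorm (f n - fun a => f n a - f₀ a) p μ := by rw [← h1]
      _ ≤ eLpNorm (f n) p μ + eLpNorm (fun a => f n a - f₀ a) p μ :=
        eLpNorm_sub_le (hLp _ (hf𝒞 n)).1 ((hLp _ (hf𝒞 n)).1.sub hLp₀.1) hp1.le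
      _ ≤ _ := by
        refine add_le_add ((hfI n).le.trans (add_le_add le_rfl
          (ENNReal.ofReal_le_ofReal ?_))) le_rfl
        exact (hδle n n le_rfl).trans (min_le_right _ _)
  have hlim1 : Filter.Tendsto (fun n : ℕ => I + ENNReal.ofReal (1 / ((n : ℝ) + 1)) +
      eLpNorm (fun a => f n a - f₀ a) p μ) Filter.atTop (𝓝 (I + ENNReal.ofReal 0 + 0)) :=
    (tendsto_const_nhds.add (ENNReal.tendsto_ofReal tendsto_one_div_add_atTop_nhds_zero_nat)).add
      hlim₀
  simp only [ENNReal.ofReal_zero, add_zero] at hlim1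
  exact ge_of_tendsto' hlim1 hbound

end Minimizing

/-! ### Admissible functions, exceptional families and extremal functions -/

namespace Foliation

variable {k q : ℕ} {M : Type*} [TopologicalSpace M]
  [ChartedSpace (EuclideanSpace ℝ (Fin (k + q))) M] {F : Foliation k q M}

theorem sUnion_eq_setOf_leaf_mem {𝓛 : Set (Set M)} (h𝓛 : 𝓛 ⊆ F.leaves) :
    ⋃₀ 𝓛 = {a | F.leaf a ∈ 𝓛} := by
  ext a
  constructor
  · rintro ⟨L, hL, ha⟩
    obtain ⟨b, rfl⟩ := h𝓛 hL
    rwa [mem_ofPred_eq, F.leaf_eq_of_mem ha]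
  · exact fun h => ⟨_, h, F.mem_leaf_self a⟩

variable [IsManifold (𝓡 (k + q)) ∞ M] [MeasurableSpace M]

theorem almostEveryLeaf_iff (g : RiemMetric (k + q) M) {𝓛 : Set (Set M)} (h𝓛 : 𝓛 ⊆ F.leaves)
    {P : Set M → Prop} :
    AlmostEveryLeaf g 𝓛 P ↔ ∀ᵐ a ∂(riemannianVolume g), F.leaf a ∈ 𝓛 → P (F.leaf a) := by
  rw [AlmostEveryLeaf, sUnion_eq_setOf_leaf_mem (F := F) ((sep_subset _ _).trans h𝓛), ae_iff]
  simp only [Classical.not_imp]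
  rfl

theorem almostEveryLeaf_leaves_iff (g : RiemMetric (k + q) M) {P : Set M → Prop} :
    AlmostEveryLeaf g F.leaves P ↔ ∀ᵐ a ∂(riemannianVolume g), P (F.leaf a) := by
  simp only [almostEveryLeaf_iff g (subset_refl F.leaves),
    show ∀ a, F.leaf a ∈ F.leaves from fun a => mem_range_self a, forall_const]

theorem ae_one_le_lintegral_leafMeasure {g : RiemMetric (k + q) M} {p : ℝ≥0∞} {f : M → ℝ}
    (hf : f ∈ F.admissible g p F.leaves) : ∀ᵐ a ∂(riemannianVolume g),
      1 ≤ ∫⁻ b, ENNReal.ofReal (f b) ∂(F.leafMeasure g (F.leaf a)) := by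
  have := (almostEveryLeaf_leaves_iff g).1 hf.2.2
  exact this

theorem midpoint_mem_admissible {g : RiemMetric (k + q) M} {p : ℝ≥0∞} {f h : M → ℝ}
    (hf : f ∈ F.admissible g p F.leaves) (hh : h ∈ F.admissible g p F.leaves) :
    (fun a => (f a + h a) / 2) ∈ F.admissible g p F.leaves := by
  refine ⟨?_, fun a => by linarith [hf.2.1 a, hh.2.1 a], (almostEveryLeaf_leaves_iff g).2 ?_⟩
  · have := (hf.1.add hh.1).const_mul (1 / 2 : ℝ)
    convert this using 1
    ext a
    simp only [Pi.add_apply]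
    ring
  · filter_upwards [ae_one_le_lintegral_leafMeasure hf,
      ae_one_le_lintegral_leafMeasure hh] with a ha hb
    have h1 : ∀ b, ENNReal.ofReal ((f b + h b) / 2) =
        2⁻¹ * (ENNReal.ofReal (f b) + ENNReal.ofReal (h b)) := by
      intro b
      rw [← ENNReal.ofReal_add (hf.2.1 b) (hh.2.1 b), ENNReal.ofReal_div_of_pos two_pos,
        ENNReal.div_eq_inv_mul]
      simp
    simp only [h1]
    rw [lintegral_const_mul' _ _ (by simp)]
    calc (1 : ℝ≥0∞) = 2⁻¹ * (1 + 1) := by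
          rw [one_add_one_eq_two, ENNReal.inv_mul_cancel (by simp) (by simp)]
      _ ≤ _ := mul_le_mul_right ((add_le_add ha hb).trans (le_lintegral_add _ _)) _

/-- A family of leaves on which functions with `Lᵖ` norms tending to zero have integrals bounded
below has modulus zero. -/
theorem modulus_eq_zero_of_tendsto {g : RiemMetric (k + q) M} {p : ℝ≥0∞} {𝓛 : Set (Set M)}
    (h𝓛 : 𝓛 ⊆ F.leaves) {c : ℝ≥0∞} (hc : c ≠ 0) (hc' : c ≠ ⊤) {u : ℕ → M → ℝ}
    (hu : ∀ n, MemLp (u n) p (riemannianVolume g)) (hu0 : ∀ n a, 0 ≤ u n a)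
    (hint : ∀ L ∈ 𝓛, ∀ n, c ≤ ∫⁻ a, ENNReal.ofReal (u n a) ∂(F.leafMeasure g L))
    (hlim : Filter.Tendsto (fun n => eLpNorm (u n) p (riemannianVolume g)) Filter.atTop (𝓝 0)) :
    F.modulus g p 𝓛 = 0 := by
  set C : ℝ := c⁻¹.toReal with hC
  have hC0 : 0 ≤ C := ENNReal.toReal_nonneg
  have hle : ∀ n, F.modulus g p 𝓛 ≤ ‖C‖ₑ * eLpNorm (u n) p (riemannianVolume g) := by
    intro n
    have hadm : (fun a => C * u n a) ∈ F.admissible g p 𝓛 := by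
      refine ⟨(hu n).const_mul _, fun a => mul_nonneg hC0 (hu0 n a), ?_⟩
      refine (almostEveryLeaf_iff g h𝓛).2 (ae_of_all _ fun a ha => ?_)
      simp only [ENNReal.ofReal_mul hC0]
      rw [lintegral_const_mul' _ _ ENNReal.ofReal_ne_top, hC,
        ENNReal.ofReal_toReal (ENNReal.inv_ne_top.2 hc)]
      calc (1 : ℝ≥0∞) = c⁻¹ * c := (ENNReal.inv_mul_cancel hc hc').symm
        _ ≤ _ := mul_le_mul_right (hint _ ha n) _
    refine (iInf₂_le _ hadm).trans_eq ?_
    exact eLpNorm_const_smul C (u n) p _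
  have hlim2 := ENNReal.Tendsto.const_mul (a := ‖C‖ₑ) hlim (Or.inr enorm_ne_top)
  rw [mul_zero] at hlim2
  exact nonpos_iff_eq_zero.1 (ge_of_tendsto' hlim2 hle)

variable [BorelSpace M] [SecondCountableTopology M]

/-- A property of almost every point of `M` holds at almost every point of almost every leaf. -/
theorem ae_ae_leafMeasure (F : Foliation k q M) (g : RiemMetric (k + q) M) {Q : M → Prop}
    (h : ∀ᵐ b ∂(riemannianVolume g), Q b) :
    ∀ᵐ a ∂(riemannianVolume g), ∀ᵐ b ∂(F.leafMeasure g (F.leaf a)), Q b := by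
  obtain ⟨N, hsub, hN, hN0⟩ := exists_measurable_superset_of_null (ae_iff.1 h)
  filter_upwards [measure_eq_zero_iff_ae_notMem.1
    (F.riemannianVolume_setOf_leafMeasure_ne_zero g hN hN0)] with a ha
  exact measure_mono_null hsub (not_not.1 ha)

theorem ae_mem_leaf (F : Foliation k q M) (g : RiemMetric (k + q) M) (a : M) :
    ∀ᵐ b ∂(F.leafMeasure g (F.leaf a)), b ∈ F.leaf a :=
  F.leafMeasure_compl_leaf g a

theorem admissible_congr {g : RiemMetric (k + q) M} {p : ℝ≥0∞} {f h : M → ℝ}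
    (hf : f ∈ F.admissible g p F.leaves) (hfh : f =ᵐ[riemannianVolume g] h) (hh : ∀ a, 0 ≤ h a) :
    h ∈ F.admissible g p F.leaves := by
  refine ⟨hf.1.ae_eq hfh, hh, (almostEveryLeaf_leaves_iff g).2 ?_⟩
  filter_upwards [ae_one_le_lintegral_leafMeasure hf, F.ae_ae_leafMeasure g hfh] with a ha hL
  refine ha.trans_eq (lintegral_congr_ae ?_)
  filter_upwards [hL] with b hb
  rw [hb]

/-- By the null set lemma, admissibility only depends on the almost everywhere class of a
nonnegative function, so it can be tested on a Borel representative. -/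
theorem exists_measurable_admissible {g : RiemMetric (k + q) M} {p : ℝ≥0∞} {f : M → ℝ}
    (hf : f ∈ F.admissible g p F.leaves) :
    ∃ h ∈ F.admissible g p F.leaves, Measurable h ∧ f =ᵐ[riemannianVolume g] h := by
  have hmeas := hf.1.1
  have heq : f =ᵐ[riemannianVolume g] fun a => max (hmeas.mk f a) 0 := by
    filter_upwards [hmeas.ae_eq_mk] with a ha
    rw [← ha, max_eq_left (hf.2.1 a)]
  exact ⟨_, admissible_congr hf heq fun a => le_max_right _ _,
    hmeas.stronglyMeasurable_mk.measurable.max measurable_const, heq⟩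

/-- If every non-negligible measurable family of leaves has positive modulus, then functions whose
`Lᵖ` norms tend to zero cannot have integrals bounded below on a non-negligible set of leaves. -/
theorem riemannianVolume_setOf_le_lintegral_eq_zero {g : RiemMetric (k + q) M} {p : ℝ≥0∞}
    (hpos : ∀ 𝓛 : Set (Set M), 𝓛 ⊆ F.leaves → NullMeasurableSet (⋃₀ 𝓛) (riemannianVolume g) →
      0 < riemannianVolume g (⋃₀ 𝓛) → 0 < F.modulus g p 𝓛)
    {c : ℝ≥0∞} (hc : c ≠ 0) (hc' : c ≠ ⊤) {u : ℕ → M → ℝ} (hum : ∀ n, Measurable (u n))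
    (hu : ∀ n, MemLp (u n) p (riemannianVolume g)) (hu0 : ∀ n a, 0 ≤ u n a)
    (hlim : Filter.Tendsto (fun n => eLpNorm (u n) p (riemannianVolume g)) Filter.atTop (𝓝 0)) :
    riemannianVolume g
      {a | ∀ n, c ≤ ∫⁻ b, ENNReal.ofReal (u n b) ∂(F.leafMeasure g (F.leaf a))} = 0 := by
  have hmeas : MeasurableSet
      {a | ∀ n, c ≤ ∫⁻ b, ENNReal.ofReal (u n b) ∂(F.leafMeasure g (F.leaf a))} := by
    simp only [ofPred_forall]
    exact MeasurableSet.iInter fun n => measurableSet_le measurable_const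
      (F.measurable_lintegral_leafMeasure g (ENNReal.measurable_ofReal.comp (hum n)))
  have h𝓛 : {L ∈ F.leaves | ∀ n, c ≤ ∫⁻ b, ENNReal.ofReal (u n b) ∂(F.leafMeasure g L)} ⊆
      F.leaves := sep_subset _ _
  have hmod := modulus_eq_zero_of_tendsto h𝓛 hc hc' hu hu0 (fun L hL => hL.2) hlim
  have hU : ⋃₀ {L ∈ F.leaves | ∀ n, c ≤ ∫⁻ b, ENNReal.ofReal (u n b) ∂(F.leafMeasure g L)} =
      {a | ∀ n, c ≤ ∫⁻ b, ENNReal.ofReal (u n b) ∂(F.leafMeasure g (F.leaf a))} := by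
    rw [sUnion_eq_setOf_leaf_mem h𝓛]
    exact Set.ext fun a => ⟨fun h => h.2, fun h => ⟨mem_range_self a, h⟩⟩
  by_contra h0
  exact (hpos _ h𝓛 (hU ▸ hmeas.nullMeasurableSet) (hU ▸ pos_iff_ne_zero.2 h0)).ne' hmod

/-- A form of Fuglede's lemma: if every non-negligible measurable family of leaves has positive
modulus, then the `Lᵖ` limit `f₀` of admissible functions `f n` is admissible. On a leaf where the
integral of `f₀` is less than one, the integrals of `|f n - f₀|` are bounded below. -/
theorem admissible_of_tendsto {g : RiemMetric (k + q) M} {p : ℝ≥0∞}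
    (hpos : ∀ 𝓛 : Set (Set M), 𝓛 ⊆ F.leaves → NullMeasurableSet (⋃₀ 𝓛) (riemannianVolume g) →
      0 < riemannianVolume g (⋃₀ 𝓛) → 0 < F.modulus g p 𝓛)
    {f : ℕ → M → ℝ} {f₀ : M → ℝ} (hf : ∀ n, f n ∈ F.admissible g p F.leaves)
    (hf₀ : Measurable f₀) (hf₀nn : ∀ a, 0 ≤ f₀ a) (hf₀p : MemLp f₀ p (riemannianVolume g))
    (hlim : Filter.Tendsto (fun n => eLpNorm (fun a => f n a - f₀ a) p (riemannianVolume g))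
      Filter.atTop (𝓝 0)) : f₀ ∈ F.admissible g p F.leaves := by
  choose h hh hhm hfh using fun n => exists_measurable_admissible (hf n)
  have hlim' : Filter.Tendsto (fun n => eLpNorm (fun a => |h n a - f₀ a|) p (riemannianVolume g))
      Filter.atTop (𝓝 0) := by
    refine hlim.congr fun n => ?_
    rw [← eLpNorm_norm fun a => f n a - f₀ a]
    refine eLpNorm_congr_ae ?_
    filter_upwards [hfh n] with a ha
    rw [ha, Real.norm_eq_abs]
  have hum : ∀ n, Measurable fun b => |h n b - f₀ b| := fun n => ((hhm n).sub hf₀).norm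
  have hu : ∀ n, MemLp (fun b => |h n b - f₀ b|) p (riemannianVolume g) := fun n =>
    ((hh n).1.sub hf₀p).norm
  have h1 : ∀ᵐ a ∂(riemannianVolume g), ∀ j : ℕ, ¬ ∀ n, ((j : ℝ≥0∞) + 1)⁻¹ ≤
      ∫⁻ b, ENNReal.ofReal |h n b - f₀ b| ∂(F.leafMeasure g (F.leaf a)) := by
    refine ae_all_iff.2 fun j => ?_
    have hc : ((j : ℝ≥0∞) + 1)⁻¹ ≠ 0 := ENNReal.inv_ne_zero.2 (by simp)
    have hc' : ((j : ℝ≥0∞) + 1)⁻¹ ≠ ⊤ := ENNReal.inv_ne_top.2 (by simp)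
    have hj := riemannianVolume_setOf_le_lintegral_eq_zero hpos hc hc' hum hu
      (fun n a => abs_nonneg _) hlim'
    exact measure_eq_zero_iff_ae_notMem.1 hj
  have h2 : ∀ᵐ a ∂(riemannianVolume g), ∀ n,
      1 ≤ ∫⁻ b, ENNReal.ofReal (h n b) ∂(F.leafMeasure g (F.leaf a)) :=
    ae_all_iff.2 fun n => ae_one_le_lintegral_leafMeasure (hh n)
  refine ⟨hf₀p, hf₀nn, (almostEveryLeaf_leaves_iff g).2 ?_⟩
  filter_upwards [h1, h2] with a ha1 ha2
  by_contra! hlt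
  obtain ⟨j, hj⟩ := ENNReal.exists_inv_nat_lt (tsub_pos_iff_lt.2 hlt).ne'
  refine ha1 j fun n => ?_
  refine (ENNReal.inv_le_inv.2 (le_add_of_nonneg_right zero_le_one)).trans (hj.le.trans ?_)
  have hf₀m : Measurable fun b => ENNReal.ofReal (f₀ b) := ENNReal.measurable_ofReal.comp hf₀
  rw [tsub_le_iff_left, ← lintegral_add_left hf₀m]
  refine (ha2 n).trans (lintegral_mono fun b => ?_)
  rw [← ENNReal.ofReal_add (hf₀nn b) (abs_nonneg _)]
  exact ENNReal.ofReal_le_ofReal (by linarith [le_abs_self (h n b - f₀ b)])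

/-- An extremal function vanishes almost everywhere on a measurable union of leaves of modulus
zero: there it could be replaced by functions of arbitrarily small norm. -/
theorem IsExtremal.ae_eq_zero {g : RiemMetric (k + q) M} {p : ℝ≥0∞} (hp1 : 1 ≤ p) (hp : p ≠ ⊤)
    {f₀ : M → ℝ} (hf₀ : F.IsExtremal g p f₀) {𝓛 : Set (Set M)} (h𝓛 : 𝓛 ⊆ F.leaves)
    (hmeas : NullMeasurableSet (⋃₀ 𝓛) (riemannianVolume g)) (hmod : F.modulus g p 𝓛 = 0) :
    ∀ᵐ a ∂(riemannianVolume g), a ∈ ⋃₀ 𝓛 → f₀ a = 0 := by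
  classical
  set μ := riemannianVolume g with hμ
  set A := ⋃₀ 𝓛 with hA
  have hA' : A = {a | F.leaf a ∈ 𝓛} := sUnion_eq_setOf_leaf_mem h𝓛
  have hp0 : p ≠ 0 := (zero_lt_one.trans_le hp1).ne'
  have hle : ∀ f ∈ F.admissible g p 𝓛,
      eLpNorm f₀ p μ ≤ eLpNorm (Aᶜ.indicator f₀) p μ + eLpNorm f p μ := by
    intro f hf
    have hsum : A.piecewise f f₀ = Aᶜ.indicator f₀ + A.indicator f := by
      ext a
      by_cases ha : a ∈ A <;> simp [ha]
    have hm1 : AEStronglyMeasurable (Aᶜ.indicator f₀) μ := hf₀.1.1.1.indicator₀ hmeas.compl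
    have hm2 : AEStronglyMeasurable (A.indicator f) μ := hf.1.1.indicator₀ hmeas
    have hnorm : eLpNorm (A.piecewise f f₀) p μ ≤
        eLpNorm (Aᶜ.indicator f₀) p μ + eLpNorm f p μ := by
      rw [hsum]
      exact (eLpNorm_add_le hm1 hm2 hp1).trans (add_le_add le_rfl (eLpNorm_indicator_le f))
    have hadm : A.piecewise f f₀ ∈ F.admissible g p F.leaves := by
      refine ⟨⟨hsum ▸ hm1.add hm2, hnorm.trans_lt (ENNReal.add_lt_top.2
        ⟨(eLpNorm_indicator_le f₀).trans_lt hf₀.1.1.2, hf.1.2⟩)⟩, fun a => ?_,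
        (almostEveryLeaf_leaves_iff g).2 ?_⟩
      · by_cases ha : a ∈ A
        · rw [piecewise_eq_of_mem _ _ _ ha]
          exact hf.2.1 a
        · rw [piecewise_eq_of_notMem _ _ _ ha]
          exact hf₀.1.2.1 a
      · filter_upwards [(almostEveryLeaf_iff g h𝓛).1 hf.2.2,
          ae_one_le_lintegral_leafMeasure hf₀.1] with a ha ha0
        by_cases haA : F.leaf a ∈ 𝓛
        · refine (ha haA).trans_eq (lintegral_congr_ae ?_)
          filter_upwards [F.ae_mem_leaf g a] with b hb
          rw [piecewise_eq_of_mem _ _ _ (show b ∈ A from ⟨_, haA, hb⟩)]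
        · refine ha0.trans_eq (lintegral_congr_ae ?_)
          filter_upwards [F.ae_mem_leaf g a] with b hb
          have : b ∉ A := by
            rw [hA', mem_ofPred_eq, F.leaf_eq_of_mem hb]
            exact haA
          rw [piecewise_eq_of_notMem _ _ _ this]
    rw [← hf₀.2]
    exact (iInf₂_le _ hadm).trans hnorm
  have hle' : eLpNorm f₀ p μ ≤ eLpNorm (Aᶜ.indicator f₀) p μ := by
    refine ENNReal.le_of_forall_pos_le_add fun ε hε _ => ?_
    have : F.modulus g p 𝓛 < ε := hmod ▸ ENNReal.coe_pos.2 hε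
    simp only [modulus, iInf_lt_iff] at this
    obtain ⟨f, hf, hfε⟩ := this
    exact (hle f hf).trans (add_le_add le_rfl hfε.le)
  -- the `p`-th powers of the norms over `A` and over its complement add up
  have hr : 0 < p.toReal := ENNReal.toReal_pos hp0 hp
  have hpow : ∀ h : M → ℝ, eLpNorm h p μ ^ p.toReal = ∫⁻ a, ‖h a‖ₑ ^ p.toReal ∂μ := by
    intro h
    rw [eLpNorm_eq_lintegral_rpow_enorm_toReal hp0 hp, ← ENNReal.rpow_mul,
      one_div_mul_cancel hr.ne', ENNReal.rpow_one]
  have hpow' := ENNReal.rpow_le_rpow hle' hr.le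
  rw [hpow, hpow] at hpow'
  have hind : ∫⁻ a, ‖Aᶜ.indicator f₀ a‖ₑ ^ p.toReal ∂μ = ∫⁻ a in Aᶜ, ‖f₀ a‖ₑ ^ p.toReal ∂μ := by
    rw [← lintegral_indicator₀ hmeas.compl]
    refine lintegral_congr fun a => ?_
    by_cases ha : a ∈ Aᶜ
    · rw [indicator_of_mem ha, indicator_of_mem ha]
    · rw [indicator_of_notMem ha, indicator_of_notMem ha]
      simp [hr]
  have hfin : ∫⁻ a in Aᶜ, ‖f₀ a‖ₑ ^ p.toReal ∂μ ≠ ⊤ := by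
    refine ((setLIntegral_le_lintegral _ _).trans_lt ?_).ne
    rw [← hpow]
    exact ENNReal.rpow_lt_top_of_nonneg hr.le hf₀.1.1.2.ne
  have hzero : ∫⁻ a in A, ‖f₀ a‖ₑ ^ p.toReal ∂μ = 0 := by
    have hsplit : μ.restrict A + μ.restrict Aᶜ = μ := by
      have := Measure.restrict_inter_add_sdiff₀ (μ := μ) univ hmeas
      rwa [univ_inter, ← compl_eq_univ_sdiff, Measure.restrict_univ] at this
    rw [hind, ← congrArg (fun ν => ∫⁻ a, ‖f₀ a‖ₑ ^ p.toReal ∂ν) hsplit,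
      lintegral_add_measure] at hpow'
    have h0 : ∫⁻ a in A, ‖f₀ a‖ₑ ^ p.toReal ∂μ + ∫⁻ a in Aᶜ, ‖f₀ a‖ₑ ^ p.toReal ∂μ ≤
        0 + ∫⁻ a in Aᶜ, ‖f₀ a‖ₑ ^ p.toReal ∂μ := by rwa [zero_add]
    exact nonpos_iff_eq_zero.1 ((ENNReal.add_le_add_iff_right hfin).1 h0)
  have hae : AEMeasurable (fun a => ‖f₀ a‖ₑ ^ p.toReal) (μ.restrict A) :=
    (hf₀.1.1.1.enorm.pow_const _).restrict
  rw [lintegral_eq_zero_iff' hae, Filter.EventuallyEq, ae_restrict_iff'₀ hmeas] at hzero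
  filter_upwards [hzero] with a ha haA
  simpa [hr, hr.not_gt] using ha haA

theorem IsExtremal.modulus_pos {g : RiemMetric (k + q) M} {p : ℝ≥0∞} (hp1 : 1 ≤ p) (hp : p ≠ ⊤)
    {f₀ : M → ℝ} (hf₀ : F.IsExtremal g p f₀) {𝓛 : Set (Set M)} (h𝓛 : 𝓛 ⊆ F.leaves)
    (hmeas : NullMeasurableSet (⋃₀ 𝓛) (riemannianVolume g))
    (hpos : 0 < riemannianVolume g (⋃₀ 𝓛)) : 0 < F.modulus g p 𝓛 := by
  by_contra hmod
  have hzero := hf₀.ae_eq_zero hp1 hp h𝓛 hmeas (nonpos_iff_eq_zero.1 (not_lt.1 hmod))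
  refine hpos.ne' (measure_eq_zero_iff_ae_notMem.2 ?_)
  filter_upwards [ae_one_le_lintegral_leafMeasure hf₀.1, F.ae_ae_leafMeasure g hzero]
    with a ha hL haA
  rw [sUnion_eq_setOf_leaf_mem h𝓛] at haA
  have : ∫⁻ b, ENNReal.ofReal (f₀ b) ∂(F.leafMeasure g (F.leaf a)) = ∫⁻ _, 0
      ∂(F.leafMeasure g (F.leaf a)) := by
    refine lintegral_congr_ae ?_
    filter_upwards [hL, F.ae_mem_leaf g a] with b hb hbL
    rw [hb ⟨_, haA, hbL⟩, ENNReal.ofReal_zero]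
  rw [this, lintegral_zero] at ha
  exact absurd ha (by simp)

end Foliation

end

theorem theorem3p1 {k q : ℕ} {M : Type*} [TopologicalSpace M] [T2Space M]
    [SecondCountableTopology M] [ChartedSpace (EuclideanSpace ℝ (Fin (k + q))) M]
    [IsManifold (𝓡 (k + q)) ∞ M] [MeasurableSpace M] [BorelSpace M]
    (g : RiemMetric (k + q) M) (F : Foliation k q M) (p : ℝ≥0∞) (hp : 1 < p) (hp_top : p ≠ ⊤)
    (hadm : (F.admissible g p F.leaves).Nonempty) :
    (∃ f₀ : M → ℝ, F.IsExtremal g p f₀) ↔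
      ∀ 𝓛 : Set (Set M), 𝓛 ⊆ F.leaves →
        NullMeasurableSet (⋃₀ 𝓛) (riemannianVolume g) →
        0 < riemannianVolume g (⋃₀ 𝓛) → 0 < F.modulus g p 𝓛 := by
  constructor
  · rintro ⟨f₀, hf₀⟩ 𝓛 h𝓛 hmeas hpos
    exact hf₀.modulus_pos hp.le hp_top h𝓛 hmeas hpos
  · intro hpos
    obtain ⟨f, f₀, hf, hm, hnn, hLp, hlim, hle⟩ := exists_tendsto_of_midpoint_mem hp hp_top hadm
      (fun f hf => hf.1) (fun f hf => hf.2.1)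
      fun f hf h hh => Foliation.midpoint_mem_admissible hf hh
    have hf₀ := Foliation.admissible_of_tendsto hpos hf hm hnn hLp hlim
    exact ⟨f₀, hf₀, le_antisymm (iInf₂_le _ hf₀) hle⟩
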